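/- Let $H$ be a compact (Hausdorff) group and let $(\iota_i : H \to G_i)_{i\in I}$ be a family of normal embeddings of compact groups, i.e. each $\iota_i$ is an injective continuous homomorphism into a compact group $G_i$ with $\iota_i(H)\trianglelefteq G_i$. The following four conditions are equivalent. (1) *Algebraic soundness*: the canonical homomorphism from the group-theoretic multi-pushout (the free product of the $G_i$ amalgamated over $H$) to the multi-pushout of $(\iota_i)$ in the category of compact groups is injective. (2) *Coherent embeddability*: there are a compact group $G$ and injective continuous homomorphisms $j_i : G_i \to G$ such that all $j_i\iota_i$ are equal. (3) *Weak coherent embeddability*: there are a compact group $G$ and continuous homomorphisms $f_i : G_i \to G$ (not necessarily injective) such that all $f_i\iota_i$ are equal and injective. (4) *Condition $\mathrm{FIN}$*: for every irreducible (necessarily finite-dimensional) unitary representation $\rho$ of $H$, the Clifford class $C_\rho$ is finite and the Clifford multiplicity $m_\rho$ is finite. Here $C_\rho$ is the orbit of the isomorphism class of $\rho$ under the action of the free product $\coprod_i G_i$ of groups, acting on representations of $H$ through its action on $H$ in which each $G_i$ acts by conjugation; and $$m_\rho=\sup_{i\in I}\ \min\{\, m_{\rho|\pi} : \pi \text{ an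 irreducible unitary representation of } G_i,\ m_{\rho|\pi}>0\,\}\in\mathbb{Z}_{\ge 0}\cup\{\infty\},$$ where $m_{\rho|\pi}$ is the multiplicity of $\rho$ in the restriction of $\pi$ to $H$ along $\iota_i$. -/

import Mathlib

open Function

universe u

noncomputable section

namespace CompactGroups

/-- A normal embedding `H ⊴ G` of topological groups: an injective continuous homomorphism with
normal image.  (Between compact Hausdorff groups such a map is automatically a homeomorphism onto
its closed image.) -/
structure IsNormalEmbedding {H G : Type u} [Group H] [TopologicalSpace H] [Group G]
    [TopologicalSpace G] (ι : H →ₜ* G) : Prop where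
  injective : Injective ι
  normal : ι.toMonoidHom.range.Normal

/-! ### Multi-pushouts, algebraic soundness, coherent embeddability -/

section Pushouts

variable {I : Type u} {H : Type u} {G : I → Type u} [Group H] [TopologicalSpace H]
  [∀ i, Group (G i)] [∀ i, TopologicalSpace (G i)]

/-- `P`, with structure maps `k : H → P` and `j i : G i → P`, is the multi-pushout of the family
`ι i : H → G i` in the category of compact (Hausdorff) groups. -/
structure IsCompactPushout (ι : ∀ i, H →ₜ* G i) (P : Type u) [Group P] [TopologicalSpace P]
    [IsTopologicalGroup P] [CompactSpace P] [T2Space P]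
    (k : H →ₜ* P) (j : ∀ i, G i →ₜ* P) : Prop where
  comm : ∀ i, (j i).comp (ι i) = k
  existsUnique_desc : ∀ (K : Type u) [Group K] [TopologicalSpace K] [IsTopologicalGroup K]
    [CompactSpace K] [T2Space K] (k' : H →ₜ* K) (j' : ∀ i, G i →ₜ* K),
    (∀ i, (j' i).comp (ι i) = k') →
      ∃! φ : P →ₜ* K, φ.comp k = k' ∧ ∀ i, φ.comp (j i) = j' i

/-- The canonical homomorphism from the group-theoretic multi-pushout (the free product of the
`G i` amalgamated over `H`) to a group `P` with compatible maps `k : H → P`, `j i : G i → P`. -/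
def fromAlgebraicPushout {ι : ∀ i, H →ₜ* G i} {P : Type u} [Group P] [TopologicalSpace P]
    {k : H →ₜ* P} {j : ∀ i, G i →ₜ* P} (h : ∀ i, (j i).comp (ι i) = k) :
    Monoid.PushoutI (fun i => (ι i).toMonoidHom) →* P :=
  Monoid.PushoutI.lift (fun i => (j i).toMonoidHom) k.toMonoidHom
    (fun i => congrArg ContinuousMonoidHom.toMonoidHom (h i))

/-- Algebraic soundness: the canonical map from the group-theoretic multi-pushout to the
multi-pushout in compact groups is one-to-one. -/
def AlgebraicallySound (ι : ∀ i, H →ₜ* G i) : Prop :=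
  ∃ (P : Type u) (_ : Group P) (_ : TopologicalSpace P) (_ : IsTopologicalGroup P)
    (_ : CompactSpace P) (_ : T2Space P) (k : H →ₜ* P) (j : ∀ i, G i →ₜ* P)
    (hP : IsCompactPushout ι P k j), Injective (fromAlgebraicPushout hP.comm)

/-- Coherent embeddability: there are embeddings `j i : G i → K` into one compact group whose
restrictions to `H` all agree. -/
def CoherentlyEmbeddable (ι : ∀ i, H →ₜ* G i) : Prop :=
  ∃ (K : Type u) (_ : Group K) (_ : TopologicalSpace K) (_ : IsTopologicalGroup K)
    (_ : CompactSpace K) (_ : T2Space K) (j : ∀ i, G i →ₜ* K),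
    (∀ i, Injective (j i)) ∧ ∀ i i', (j i).comp (ι i) = (j i').comp (ι i')

/-- Weak coherent embeddability: there are morphisms `f i : G i → K` into one compact group whose
restrictions to `H` all agree and are injective. -/
def WeaklyCoherentlyEmbeddable (ι : ∀ i, H →ₜ* G i) : Prop :=
  ∃ (K : Type u) (_ : Group K) (_ : TopologicalSpace K) (_ : IsTopologicalGroup K)
    (_ : CompactSpace K) (_ : T2Space K) (f : ∀ i, G i →ₜ* K),
    (∀ i, Injective ((f i).comp (ι i))) ∧ ∀ i i', (f i).comp (ι i) = (f i').comp (ι i')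

end Pushouts

/-! ### Unitary representations -/

/-- A continuous unitary representation on some `ℂⁿ`.  Since irreducible unitary representations
of a compact group are finite-dimensional, these include all irreducible ones up to unitary
equivalence. -/
structure UnitaryRep (G : Type u) [Group G] [TopologicalSpace G] where
  dim : ℕ
  toHom : G →ₜ* Matrix.unitaryGroup (Fin dim) ℂ

namespace UnitaryRep

variable {G H : Type u} [Group G] [TopologicalSpace G] [Group H] [TopologicalSpace H]

/-- The matrix by which a group element acts. -/
def mat (π : UnitaryRep G) (g : G) : Matrix (Fin π.dim) (Fin π.dim) ℂ := π.toHom g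

/-- The underlying linear representation. -/
def rep (π : UnitaryRep G) : Representation ℂ G (Fin π.dim → ℂ) where
  toFun g := Matrix.toLin' (π.mat g)
  map_one' := by simp [mat]; rfl
  map_mul' a b := by simp [mat, Matrix.toLin'_mul]; rfl

/-- Pullback of a representation along a morphism; restriction along an embedding. -/
def comp (π : UnitaryRep G) (f : H →ₜ* G) : UnitaryRep H where
  dim := π.dim
  toHom := π.toHom.comp f

/-- Unitary equivalence. -/
def Equivalent (ρ σ : UnitaryRep G) : Prop :=
  ∃ U : Matrix (Fin σ.dim) (Fin ρ.dim) ℂ,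
    U.conjTranspose * U = 1 ∧ U * U.conjTranspose = 1 ∧ ∀ g, U * ρ.mat g = σ.mat g * U

/-- The number of times an irreducible `ρ` occurs in `σ`, namely the dimension of the space of
intertwiners `ρ → σ`. -/
def multiplicity (ρ σ : UnitaryRep G) : ℕ :=
  Module.finrank ℂ (Representation.IntertwiningMap ρ.rep σ.rep)

/-- Unitary equivalence as an equivalence relation. -/
instance setoid (G : Type u) [Group G] [TopologicalSpace G] : Setoid (UnitaryRep G) where
  r := Equivalent
  iseqv :=
    { refl := fun ρ => ⟨1, by simp, by simp, by simp⟩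
      symm := by
        rintro ρ σ ⟨U, h1, h2, h3⟩
        refine ⟨U.conjTranspose, by simpa using h2, by simpa using h1, fun g => ?_⟩
        calc U.conjTranspose * σ.mat g
            = U.conjTranspose * (σ.mat g * U) * U.conjTranspose := by
              rw [Matrix.mul_assoc, Matrix.mul_assoc, h2, Matrix.mul_one]
          _ = ρ.mat g * U.conjTranspose := by
              rw [← h3, ← Matrix.mul_assoc, h1, Matrix.one_mul]
      trans := by
        rintro ρ σ τ ⟨U, h1, h2, h3⟩ ⟨W, k1, k2, k3⟩
        refine ⟨W * U, ?_, ?_, fun g => ?_⟩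
        · rw [Matrix.conjTranspose_mul, Matrix.mul_assoc, ← Matrix.mul_assoc W.conjTranspose, k1,
            Matrix.one_mul, h1]
        · rw [Matrix.conjTranspose_mul, Matrix.mul_assoc, ← Matrix.mul_assoc U, h2,
            Matrix.one_mul, k2]
        · rw [Matrix.mul_assoc, h3, ← Matrix.mul_assoc, k3, Matrix.mul_assoc] }

end UnitaryRep

/-! ### The conjugation action of the free product -/

section Conjugation

variable {H G : Type u} [Group H] [TopologicalSpace H] [Group G] [TopologicalSpace G]
  {ι : H →ₜ* G}

/-- The conjugation action of `G` on a normally embedded `H`. -/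
def conjAut (h : IsNormalEmbedding ι) : G →* MulAut H :=
  haveI := h.normal
  (MulAut.congr (MonoidHom.ofInjective (f := ι.toMonoidHom) h.injective).symm).toMonoidHom.comp
    MulAut.conjNormal

theorem map_conjAut (h : IsNormalEmbedding ι) (g : G) (x : H) :
    ι (conjAut h g x) = g * ι x * g⁻¹ := by
  have := h.normal
  have key : ∀ y : ι.toMonoidHom.range,
      ι ((MonoidHom.ofInjective (f := ι.toMonoidHom) h.injective).symm y) = y := fun y =>
    congrArg Subtype.val
      ((MonoidHom.ofInjective (f := ι.toMonoidHom) h.injective).apply_symm_apply y)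
  exact (key _).trans (MulAut.conjNormal_apply g _)

theorem continuous_conjAut [CompactSpace H] [T2Space G] [IsTopologicalGroup G]
    (h : IsNormalEmbedding ι) (g : G) : Continuous (conjAut h g) := by
  have hc : Continuous ι := ι.continuous_toFun
  have he : Topology.IsClosedEmbedding ι := hc.isClosedEmbedding h.injective
  rw [he.isInducing.continuous_iff]
  have : (ι ∘ conjAut h g) = fun x => g * ι x * g⁻¹ := funext (map_conjAut h g)
  rw [this]
  fun_prop

end Conjugation

section Clifford

variable {I : Type u} {H : Type u} {G : I → Type u} [Group H] [TopologicalSpace H]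
  [CompactSpace H] [∀ i, Group (G i)] [∀ i, TopologicalSpace (G i)]
  [∀ i, IsTopologicalGroup (G i)] [∀ i, T2Space (G i)] {ι : ∀ i, H →ₜ* G i}

/-- The action on `H` of the group-theoretic coproduct (free product) of the `G i`, by which each
`G i` acts by conjugation. -/
def coprodAut (h : ∀ i, IsNormalEmbedding (ι i)) : Monoid.CoprodI G →* MulAut H :=
  Monoid.CoprodI.lift fun i => conjAut (h i)

theorem continuous_coprodAut (h : ∀ i, IsNormalEmbedding (ι i)) (γ : Monoid.CoprodI G) :
    Continuous (coprodAut h γ) := by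
  induction γ using Monoid.CoprodI.induction_on with
  | one => simpa using continuous_id
  | of i g => simpa [coprodAut] using continuous_conjAut (h i) g
  | mul a b ha hb =>
    rw [map_mul]
    exact ha.comp hb

/-- The continuous endomorphism of `H` by which an element of the free product acts. -/
def coprodEnd (h : ∀ i, IsNormalEmbedding (ι i)) (γ : Monoid.CoprodI G) : H →ₜ* H where
  toMonoidHom := (coprodAut h γ).toMonoidHom
  continuous_toFun := continuous_coprodAut h γ

/-- The Clifford class of `ρ` with respect to a family of normal embeddings: the orbit of the
equivalence class of `ρ` under the free product, with `(γ • ρ)(x) = ρ(γ⁻¹ • x)`. -/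
def cliffordClass (h : ∀ i, IsNormalEmbedding (ι i)) (ρ : UnitaryRep H) :
    Set (Quotient (UnitaryRep.setoid H)) :=
  Set.range fun γ : Monoid.CoprodI G => Quotient.mk _ (ρ.comp (coprodEnd h γ⁻¹))

end Clifford

/-- The Clifford multiplicity of `ρ` with respect to a single `ι : H → G`: the smallest strictly
positive multiplicity of `ρ` in `π` restricted to `H`, for `π` irreducible over `G`. -/
def cliffordMultiplicity {H G : Type u} [Group H] [TopologicalSpace H] [Group G]
    [TopologicalSpace G] (ι : H →ₜ* G) (ρ : UnitaryRep H) : ℕ∞ :=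
  sInf {m : ℕ∞ | ∃ π : UnitaryRep G, π.rep.IsIrreducible ∧
    m = (ρ.multiplicity (π.comp ι) : ℕ∞) ∧ 0 < m}

/-- The Clifford multiplicity of `ρ` with respect to a family. -/
def familyCliffordMultiplicity {I : Type u} {H : Type u} {G : I → Type u} [Group H]
    [TopologicalSpace H] [∀ i, Group (G i)] [∀ i, TopologicalSpace (G i)]
    (ι : ∀ i, H →ₜ* G i) (ρ : UnitaryRep H) : ℕ∞ :=
  ⨆ i, cliffordMultiplicity (ι i) ρ

/-- The finiteness condition `FIN`: for every irreducible unitary representation of `H`, its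
Clifford class and its Clifford multiplicity with respect to the family are both finite. -/
def FIN {I : Type u} {H : Type u} {G : I → Type u} [Group H] [TopologicalSpace H]
    [CompactSpace H] [∀ i, Group (G i)] [∀ i, TopologicalSpace (G i)]
    [∀ i, IsTopologicalGroup (G i)] [∀ i, T2Space (G i)] {ι : ∀ i, H →ₜ* G i}
    (h : ∀ i, IsNormalEmbedding (ι i)) : Prop :=
  ∀ ρ : UnitaryRep H, ρ.rep.IsIrreducible →
    (cliffordClass h ρ).Finite ∧ familyCliffordMultiplicity ι ρ < ⊤

end CompactGroups

end

/-! The four conditions are proved in a cycle. Soundness gives coherent embeddings because each `G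
i` injects into the amalgamated product, and coherent embeddings are weakly coherent.

From weak embeddings to `FIN`: let `k : H → K` be the common injective restriction. By Peter–Weyl
(`exists_mat_ne_one`) and Stone–Weierstrass, every irreducible `ρ` of `H` occurs in the restriction
of some finite-dimensional `π` of `K` (`exists_multiplicity_comp_pos`). The free product acts on
`k(H)` by conjugation inside `K`, so all translates of `ρ` occur in that restriction with the same
multiplicity. Hence they form finitely many classes, and this one multiplicity, read through the
maps `f i`, bounds the Clifford multiplicity uniformly in `i` (`FIN_of_compatible`).

From `FIN` to soundness: the compact pushout is realised as the closure of the image of the amalgam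
in the product of the unitary groups of all families of unitary representations of the `G i` that
agree on `H`. Injectivity then means that such families separate the points of the amalgam.

A nontrivial element of `H` is moved by some irreducible `ρ`. By Clifford's theorem an irreducible
representation of `G i` meeting the finite class `C` of `ρ` restricts to a constant multiple of a
single `G i`-orbit in `C`. `FIN` bounds these multiples independently of `i`, so one factorial `N`
is reached for every `i`: some representation of `G i` restricts to `N` times the sum of `C`
(`exists_rep_multiplicity_eq`). These restrictions are equivalent, and become equal after
conjugation (`exists_compatible_of_FIN`).

An element whose normal form has letters outside `H` needs no finiteness. Killing `H` turns it into
a nontrivial alternating word in the free product of the compact groups `G i / H`, and such words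
are detected by explicit unitary matrices (`exists_wordMat_ne_zero`). -/

noncomputable section
namespace CompactGroups
namespace UnitaryRep
open Matrix

variable {G H : Type u} [Group G] [TopologicalSpace G] [Group H] [TopologicalSpace H]

/-! ### Matrices of unitary representations -/

@[simp] theorem mat_one (σ : UnitaryRep G) : σ.mat 1 = 1 := by simp [mat]

@[simp] theorem mat_mul (σ : UnitaryRep G) (a b : G) : σ.mat (a * b) = σ.mat a * σ.mat b := by
  simp [mat]

theorem star_mat_mul_mat (σ : UnitaryRep G) (g : G) : (σ.mat g)ᴴ * σ.mat g = 1 :=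
  Matrix.mem_unitaryGroup_iff'.1 (σ.toHom g).2

theorem mat_mul_star_mat (σ : UnitaryRep G) (g : G) : σ.mat g * (σ.mat g)ᴴ = 1 :=
  Matrix.mem_unitaryGroup_iff.1 (σ.toHom g).2

theorem star_mat (σ : UnitaryRep G) (g : G) : (σ.mat g)ᴴ = σ.mat g⁻¹ := by
  have h : σ.mat g⁻¹ * σ.mat g = 1 := by rw [← mat_mul]; simp
  calc (σ.mat g)ᴴ = (σ.mat g⁻¹ * σ.mat g) * (σ.mat g)ᴴ := by rw [h, one_mul]
    _ = σ.mat g⁻¹ := by rw [mul_assoc, mat_mul_star_mat, mul_one]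

theorem continuous_mat (σ : UnitaryRep G) : Continuous σ.mat :=
  continuous_subtype_val.comp σ.toHom.continuous_toFun

/-- A continuous homomorphism into a unitary group from its matrices. -/
def unitaryHom {n : Type*} [Fintype n] [DecidableEq n] (f : G → Matrix n n ℂ) (h1 : f 1 = 1)
    (hmul : ∀ a b, f (a * b) = f a * f b) (hu : ∀ g, (f g)ᴴ * f g = 1) (hc : Continuous f) :
    G →ₜ* Matrix.unitaryGroup n ℂ where
  toFun g := ⟨f g, Matrix.mem_unitaryGroup_iff'.2 (hu g)⟩
  map_one' := Subtype.ext h1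
  map_mul' a b := Subtype.ext (hmul a b)
  continuous_toFun := hc.subtype_mk _

/-- The unitary representation with given matrices. -/
def ofMat {n : ℕ} (f : G → Matrix (Fin n) (Fin n) ℂ) (h1 : f 1 = 1)
    (hmul : ∀ a b, f (a * b) = f a * f b) (hu : ∀ g, (f g)ᴴ * f g = 1) (hc : Continuous f) :
    UnitaryRep G where
  dim := n
  toHom := unitaryHom f h1 hmul hu hc

/-- Reindexing of a unitary representation on `ℂⁿ`, for a finite type `n`. -/
def ofHom {n : Type*} [Fintype n] [DecidableEq n] (f : G →ₜ* Matrix.unitaryGroup n ℂ) :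
    UnitaryRep G where
  dim := Fintype.card n
  toHom := unitaryHom (fun g => (f g : Matrix n n ℂ).submatrix (Fintype.equivFin n).symm
      (Fintype.equivFin n).symm) (by simp) (fun a b => by simp [Matrix.submatrix_mul_equiv])
    (fun g => by
      rw [Matrix.conjTranspose_submatrix, Matrix.submatrix_mul_equiv]
      have : (f g : Matrix n n ℂ)ᴴ * (f g : Matrix n n ℂ) = 1 :=
        Matrix.mem_unitaryGroup_iff'.1 (f g).2
      rw [this, Matrix.submatrix_one_equiv])
    ((continuous_subtype_val.comp f.continuous_toFun).matrix_submatrix _ _)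

theorem mat_ofHom {n : Type*} [Fintype n] [DecidableEq n] (f : G →ₜ* Matrix.unitaryGroup n ℂ)
    (g : G) : (ofHom f).mat g = (f g : Matrix n n ℂ).submatrix (Fintype.equivFin n).symm
      (Fintype.equivFin n).symm := rfl

/-! ### Intertwiners -/

/-- The space of matrices intertwining two unitary representations. -/
def intertwiners (ρ σ : UnitaryRep G) : Submodule ℂ (Matrix (Fin σ.dim) (Fin ρ.dim) ℂ) where
  carrier := {A | ∀ g, A * ρ.mat g = σ.mat g * A}
  add_mem' {A B} hA hB g := by rw [Matrix.add_mul, Matrix.mul_add, hA g, hB g]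
  zero_mem' g := by simp
  smul_mem' c A hA g := by rw [Matrix.smul_mul, hA g, Matrix.mul_smul]

/-- Intertwining maps are the same as intertwining matrices. -/
def intertwiningEquiv (ρ σ : UnitaryRep G) :
    Representation.IntertwiningMap ρ.rep σ.rep ≃ₗ[ℂ] intertwiners ρ σ where
  toFun f := ⟨LinearMap.toMatrix' f.toLinearMap, fun g => by
    have := congrArg LinearMap.toMatrix' (f.isIntertwining' g)
    simpa [LinearMap.toMatrix'_comp, rep] using this⟩
  map_add' f g := by ext1; simp
  map_smul' c f := by ext1; simp
  invFun A := ⟨Matrix.toLin' A.1, fun g => by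
    have := congrArg Matrix.toLin' (A.2 g)
    simpa [Matrix.toLin'_mul, rep] using this⟩
  left_inv f := by ext1; simp
  right_inv A := by ext1; simp

theorem multiplicity_eq_finrank (ρ σ : UnitaryRep G) :
    ρ.multiplicity σ = Module.finrank ℂ (intertwiners ρ σ) :=
  (intertwiningEquiv ρ σ).finrank_eq

theorem multiplicity_pos_iff {ρ σ : UnitaryRep G} :
    0 < ρ.multiplicity σ ↔ ∃ A ∈ intertwiners ρ σ, A ≠ 0 := by
  rw [multiplicity_eq_finrank, Module.finrank_pos_iff, Submodule.nontrivial_iff_ne_bot,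
    Submodule.ne_bot_iff]

theorem intertwiners_mul {ρ σ τ : UnitaryRep G} {A : Matrix (Fin σ.dim) (Fin ρ.dim) ℂ}
    {B : Matrix (Fin τ.dim) (Fin σ.dim) ℂ} (hB : B ∈ intertwiners σ τ)
    (hA : A ∈ intertwiners ρ σ) : B * A ∈ intertwiners ρ τ := fun g => by
  rw [Matrix.mul_assoc, hA g, ← Matrix.mul_assoc, hB g, Matrix.mul_assoc]

theorem intertwiners_star {ρ σ : UnitaryRep G} {A : Matrix (Fin σ.dim) (Fin ρ.dim) ℂ}
    (hA : A ∈ intertwiners ρ σ) : Aᴴ ∈ intertwiners σ ρ := fun g => by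
  have := congrArg conjTranspose (hA g⁻¹)
  rw [conjTranspose_mul, conjTranspose_mul, star_mat, star_mat, inv_inv] at this
  exact this.symm

theorem one_mem_intertwiners (ρ : UnitaryRep G) : (1 : Matrix _ _ ℂ) ∈ intertwiners ρ ρ :=
  fun g => by simp

theorem intertwiners_comp {ρ σ : UnitaryRep G} {A : Matrix (Fin σ.dim) (Fin ρ.dim) ℂ}
    (hA : A ∈ intertwiners ρ σ) (f : H →ₜ* G) : A ∈ intertwiners (ρ.comp f) (σ.comp f) :=
  fun x => hA (f x)

/-! ### Invariant subspaces -/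

/-- The columns of `U` are an orthonormal basis of `W`, so `U * Uᴴ` is the orthogonal projection
onto `W`. Invariance says that this projection fixes `σ.mat g * U`, which makes the compression `Uᴴ
* σ.mat g * U` multiplicative and unitary. -/
theorem exists_subrep (σ : UnitaryRep G) (W : Submodule ℂ (Fin σ.dim → ℂ))
    (hW : ∀ g, ∀ v ∈ W, σ.mat g *ᵥ v ∈ W) :
    ∃ (κ : UnitaryRep G) (U : Matrix (Fin σ.dim) (Fin κ.dim) ℂ), Uᴴ * U = 1 ∧
      U ∈ intertwiners κ σ ∧ ∀ v, v ∈ W ↔ (U * Uᴴ) *ᵥ v = v := by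
  let W' : Submodule ℂ (EuclideanSpace ℂ (Fin σ.dim)) :=
    W.comap (WithLp.linearEquiv 2 ℂ (Fin σ.dim → ℂ)).toLinearMap
  let b := stdOrthonormalBasis ℂ W'
  let n := Module.finrank ℂ W'
  let U : Matrix (Fin σ.dim) (Fin n) ℂ := Matrix.of fun i j => (b j : EuclideanSpace ℂ _) i
  have hcol : ∀ x : Fin n → ℂ, U *ᵥ x ∈ W := by
    intro x
    have : U *ᵥ x = ∑ j, x j • (fun i => (b j : EuclideanSpace ℂ _) i) := by
      ext i
      simp [U, Matrix.mulVec, dotProduct, mul_comm]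
    rw [this]
    exact W.sum_mem fun j _ => W.smul_mem _ (b j).2
  have hUU : Uᴴ * U = 1 := by
    ext j k
    have := orthonormal_iff_ite.1 b.orthonormal j k
    rw [Submodule.coe_inner, PiLp.inner_apply] at this
    simp only [Matrix.mul_apply, Matrix.conjTranspose_apply, Matrix.one_apply]
    rw [← this]
    simp [U, mul_comm]
  have hmem : ∀ v, v ∈ W ↔ (U * Uᴴ) *ᵥ v = v := by
    intro v
    constructor
    · intro hv
      let v' : W' := ⟨WithLp.toLp 2 v, hv⟩
      obtain ⟨x, rfl⟩ : ∃ x : Fin n → ℂ, v = U *ᵥ x := by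
        refine ⟨fun j => b.repr v' j, ?_⟩
        have := congrArg (fun w : W' => (w : EuclideanSpace ℂ (Fin σ.dim))) (b.sum_repr v')
        ext i
        have := congrArg (fun w : EuclideanSpace ℂ (Fin σ.dim) => w i) this
        simp only [Submodule.coe_sum, Submodule.coe_smul, WithLp.ofLp_sum, Finset.sum_apply,
          WithLp.ofLp_smul, Pi.smul_apply, smul_eq_mul] at this
        rw [show v i = (v' : EuclideanSpace ℂ (Fin σ.dim)) i from rfl, ← this]
        exact Finset.sum_congr rfl fun x _ => mul_comm _ _
      rw [Matrix.mulVec_mulVec, Matrix.mul_assoc, hUU, Matrix.mul_one]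
    · intro hv
      rw [← hv, ← Matrix.mulVec_mulVec]
      exact hcol _
  have hmat : ∀ g, U * Uᴴ * (σ.mat g * U) = σ.mat g * U := by
    intro g
    refine Matrix.ext_of_mulVec_single fun j => ?_
    rw [← Matrix.mulVec_mulVec, ← hmem, ← Matrix.mulVec_mulVec]
    exact hW g _ (hcol _)
  refine ⟨ofMat (n := n) (fun g => Uᴴ * (σ.mat g * U)) (by simp [hUU]) ?_ ?_ ?_, U, hUU, ?_, hmem⟩
  · intro a c
    calc Uᴴ * (σ.mat (a * c) * U) = Uᴴ * (σ.mat a * (σ.mat c * U)) := by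
          rw [mat_mul, Matrix.mul_assoc]
      _ = Uᴴ * (σ.mat a * (U * Uᴴ * (σ.mat c * U))) := by rw [hmat]
      _ = Uᴴ * (σ.mat a * U) * (Uᴴ * (σ.mat c * U)) := by simp only [Matrix.mul_assoc]
  · intro g
    rw [conjTranspose_mul, conjTranspose_mul, conjTranspose_conjTranspose]
    calc Uᴴ * (σ.mat g)ᴴ * U * (Uᴴ * (σ.mat g * U))
        = Uᴴ * (σ.mat g)ᴴ * (U * Uᴴ * (σ.mat g * U)) := by simp only [Matrix.mul_assoc]
      _ = Uᴴ * ((σ.mat g)ᴴ * σ.mat g) * U := by rw [hmat]; simp only [Matrix.mul_assoc]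
      _ = 1 := by rw [star_mat_mul_mat, Matrix.mul_one, hUU]
  · exact continuous_const.matrix_mul (σ.continuous_mat.matrix_mul continuous_const)
  · intro g
    change U * (Uᴴ * (σ.mat g * U)) = _
    rw [← Matrix.mul_assoc, hmat]
    rfl

theorem mul_eq_self_of_forall_mulVec {n m : Type*} [Fintype n] [Fintype m] [DecidableEq m]
    (P : Matrix n n ℂ) (A : Matrix n m ℂ) (h : ∀ v, P *ᵥ (A *ᵥ v) = A *ᵥ v) : P * A = A :=
  Matrix.ext_of_mulVec_single fun j => by rw [← Matrix.mulVec_mulVec, h]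

theorem exists_kernel {σ τ : UnitaryRep G} {B : Matrix (Fin τ.dim) (Fin σ.dim) ℂ}
    (hB : B ∈ intertwiners σ τ) :
    ∃ (κ : UnitaryRep G) (U : Matrix (Fin σ.dim) (Fin κ.dim) ℂ), Uᴴ * U = 1 ∧
      U ∈ intertwiners κ σ ∧ B * U = 0 ∧ ∀ v, B *ᵥ v = 0 → (U * Uᴴ) *ᵥ v = v := by
  obtain ⟨κ, U, hU, hUi, hW⟩ := exists_subrep σ (LinearMap.ker (Matrix.toLin' B)) (by
    intro g v hv
    simp only [LinearMap.mem_ker, Matrix.toLin'_apply] at hv ⊢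
    rw [Matrix.mulVec_mulVec, hB g, ← Matrix.mulVec_mulVec, hv, Matrix.mulVec_zero])
  simp only [LinearMap.mem_ker, Matrix.toLin'_apply] at hW
  refine ⟨κ, U, hU, hUi, ?_, fun v => (hW v).1⟩
  refine Matrix.ext_of_mulVec_single fun j => ?_
  rw [← Matrix.mulVec_mulVec, Matrix.zero_mulVec, hW, Matrix.mulVec_mulVec, Matrix.mul_assoc, hU,
    Matrix.mul_one]

/-- `U` and `V` exhibit `σ` as the orthogonal direct sum of `κ` and `κ'`. -/
structure IsSum (σ κ κ' : UnitaryRep G) (U : Matrix (Fin σ.dim) (Fin κ.dim) ℂ)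
    (V : Matrix (Fin σ.dim) (Fin κ'.dim) ℂ) : Prop where
  memU : U ∈ intertwiners κ σ
  memV : V ∈ intertwiners κ' σ
  UU : Uᴴ * U = 1
  VV : Vᴴ * V = 1
  UV : Uᴴ * V = 0
  VU : Vᴴ * U = 0
  sum : U * Uᴴ + V * Vᴴ = 1

theorem IsSum.comp {σ κ κ' : UnitaryRep G} {U : Matrix (Fin σ.dim) (Fin κ.dim) ℂ}
    {V : Matrix (Fin σ.dim) (Fin κ'.dim) ℂ} (h : IsSum σ κ κ' U V) (f : H →ₜ* G) :
    IsSum (σ.comp f) (κ.comp f) (κ'.comp f) U V :=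
  ⟨intertwiners_comp h.memU f, intertwiners_comp h.memV f, h.UU, h.VV, h.UV, h.VU, h.sum⟩

theorem IsSum.dim_eq {σ κ κ' : UnitaryRep G} {U : Matrix (Fin σ.dim) (Fin κ.dim) ℂ}
    {V : Matrix (Fin σ.dim) (Fin κ'.dim) ℂ} (h : IsSum σ κ κ' U V) :
    σ.dim = κ.dim + κ'.dim := by
  have := congrArg Matrix.trace h.sum
  rw [Matrix.trace_add, Matrix.trace_mul_comm, h.UU, Matrix.trace_mul_comm, h.VV] at this
  simp only [Matrix.trace_one, Fintype.card_fin] at this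
  exact_mod_cast this.symm

/-- The complement is the kernel of `Uᴴ`. It contains the range of `1 - U * Uᴴ`, which is therefore
fixed by `V * Vᴴ`; this yields the resolution of the identity. -/
theorem exists_complement {κ σ : UnitaryRep G} {U : Matrix (Fin σ.dim) (Fin κ.dim) ℂ}
    (hU : Uᴴ * U = 1) (hUi : U ∈ intertwiners κ σ) :
    ∃ (κ' : UnitaryRep G) (V : Matrix (Fin σ.dim) (Fin κ'.dim) ℂ), IsSum σ κ κ' U V := by
  obtain ⟨κ', V, hV, hVi, hUV, hker⟩ := exists_kernel (intertwiners_star hUi)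
  have hVU : Vᴴ * U = 0 := by
    have := congrArg conjTranspose hUV
    simpa using this
  refine ⟨κ', V, hUi, hVi, hU, hV, hUV, hVU, ?_⟩
  have : V * Vᴴ * (1 - U * Uᴴ) = 1 - U * Uᴴ := by
    refine mul_eq_self_of_forall_mulVec _ _ fun v => hker _ ?_
    rw [Matrix.mulVec_mulVec, Matrix.mul_sub, ← Matrix.mul_assoc, hU]
    simp
  rw [Matrix.mul_sub, Matrix.mul_one, Matrix.mul_assoc V, ← Matrix.mul_assoc Vᴴ, hVU] at this
  simp only [Matrix.zero_mul, Matrix.mul_zero, sub_zero] at this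
  rw [this]; abel

/-- Multiplicities are additive. -/
theorem IsSum.multiplicity {σ κ κ' : UnitaryRep G} {U : Matrix (Fin σ.dim) (Fin κ.dim) ℂ}
    {V : Matrix (Fin σ.dim) (Fin κ'.dim) ℂ} (h : IsSum σ κ κ' U V) (ρ : UnitaryRep G) :
    ρ.multiplicity σ = ρ.multiplicity κ + ρ.multiplicity κ' := by
  rw [multiplicity_eq_finrank, multiplicity_eq_finrank, multiplicity_eq_finrank,
    ← Module.finrank_prod]
  refine LinearEquiv.finrank_eq
    { toFun A := (⟨Uᴴ * A.1, intertwiners_mul (intertwiners_star h.memU) A.2⟩,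
        ⟨Vᴴ * A.1, intertwiners_mul (intertwiners_star h.memV) A.2⟩)
      map_add' A B := by
        refine Prod.ext (Subtype.ext ?_) (Subtype.ext ?_) <;> simp [Matrix.mul_add]
      map_smul' c A := by
        refine Prod.ext (Subtype.ext ?_) (Subtype.ext ?_) <;> simp
      invFun p := ⟨U * p.1.1 + V * p.2.1, Submodule.add_mem _ (intertwiners_mul h.memU p.1.2)
        (intertwiners_mul h.memV p.2.2)⟩
      left_inv A := Subtype.ext ?_
      right_inv p := Prod.ext (Subtype.ext ?_) (Subtype.ext ?_) }
  · change U * (Uᴴ * A.1) + V * (Vᴴ * A.1) = A.1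
    rw [← Matrix.mul_assoc, ← Matrix.mul_assoc, ← Matrix.add_mul, h.sum, Matrix.one_mul]
  · change Uᴴ * (U * p.1.1 + V * p.2.1) = p.1.1
    rw [Matrix.mul_add, ← Matrix.mul_assoc, ← Matrix.mul_assoc, h.UU, h.UV]
    simp
  · change Vᴴ * (U * p.1.1 + V * p.2.1) = p.2.1
    rw [Matrix.mul_add, ← Matrix.mul_assoc, ← Matrix.mul_assoc, h.VV, h.VU]
    simp

/-! ### Irreducibility -/

/-- One direction is Schur's lemma over `ℂ`. Conversely, the projection onto an invariant subspace
commutes with the action, so it is a scalar idempotent, hence 0 or 1. Positive dimension excludes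
the zero representation, whose commutant is trivially scalar. -/
theorem isIrreducible_iff {ρ : UnitaryRep G} :
    ρ.rep.IsIrreducible ↔
      0 < ρ.dim ∧ ∀ A ∈ intertwiners ρ ρ, ∃ c : ℂ, A = c • (1 : Matrix _ _ ℂ) := by
  constructor
  · intro h
    refine ⟨?_, fun A hA => ?_⟩
    · by_contra h0
      have h0 : ρ.dim = 0 := by omega
      have : Subsingleton (Fin ρ.dim → ℂ) := by rw [h0]; infer_instance
      obtain ⟨W, W', hne⟩ := (inferInstance : Nontrivial (Subrepresentation ρ.rep))
      apply hne
      apply Subrepresentation.toSubmodule_injective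
      exact Subsingleton.elim _ _
    · let f := (intertwiningEquiv ρ ρ).symm ⟨A, hA⟩
      obtain ⟨c, hc⟩ := (Representation.IsIrreducible.algebraMap_intertwiningMap_bijective_of_isAlgClosed (ρ := ρ.rep) (k := ℂ)).2 f
      refine ⟨c, ?_⟩
      have h1 : c • (1 : Representation.IntertwiningMap ρ.rep ρ.rep) = f := by
        rw [← hc, Algebra.algebraMap_eq_smul_one]
      have h2 := congrArg (intertwiningEquiv ρ ρ) h1
      rw [LinearEquiv.map_smul, LinearEquiv.apply_symm_apply] at h2
      have h3 := congrArg Subtype.val h2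
      refine h3.symm.trans ?_
      change c • LinearMap.toMatrix' (LinearMap.id) = _
      simp
  · rintro ⟨h0, hA⟩
    have : Nonempty (Fin ρ.dim) := ⟨⟨0, h0⟩⟩
    refine { exists_pair_ne := ⟨⊥, ⊤, fun h => ?_⟩, eq_bot_or_eq_top := fun W => ?_ }
    · have := congrArg Subrepresentation.toSubmodule h
      exact bot_ne_top (α := Submodule ℂ (Fin ρ.dim → ℂ)) this
    · obtain ⟨κ, U, hU, hUi, hW⟩ := exists_subrep ρ W.toSubmodule
        (fun g v hv => W.apply_mem_toSubmodule g hv)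
      obtain ⟨c, hc⟩ := hA _ (intertwiners_mul hUi (intertwiners_star hUi))
      by_cases hc0 : c = 0
      · left
        apply Subrepresentation.toSubmodule_injective
        change W.toSubmodule = ⊥
        rw [Submodule.eq_bot_iff]
        intro v hv
        rw [← (hW v).1 hv, hc, hc0]
        simp
      · right
        apply Subrepresentation.toSubmodule_injective
        change W.toSubmodule = ⊤
        rw [Submodule.eq_top_iff']
        intro v
        rw [hW]
        have h1 : U * Uᴴ * (U * Uᴴ) = U * Uᴴ := by
          rw [Matrix.mul_assoc, ← Matrix.mul_assoc Uᴴ, hU, Matrix.one_mul]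
        have h2 : U * Uᴴ = 1 := by
          rw [hc] at h1 ⊢
          have h3 : (c * c) • (1 : Matrix (Fin ρ.dim) (Fin ρ.dim) ℂ) = c • 1 := by
            simpa [smul_smul] using h1
          have h4 := congrFun (congrFun h3 ⟨0, h0⟩) ⟨0, h0⟩
          simp only [Matrix.smul_apply, Matrix.one_apply_eq, smul_eq_mul, mul_one] at h4
          rw [mul_eq_left₀ hc0] at h4
          rw [h4, one_smul]
        rw [h2, Matrix.one_mulVec]

end UnitaryRep
end CompactGroups

/-! ### Unitary equivalence and decomposition into irreducibles -/

namespace CompactGroups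
namespace UnitaryRep
open Matrix
open scoped ComplexOrder

variable {G H : Type u} [Group G] [TopologicalSpace G] [Group H] [TopologicalSpace H]

theorem isIrreducible_comp {ρ : UnitaryRep G} (hρ : ρ.rep.IsIrreducible) {f : H →ₜ* G}
    (hf : Surjective f) : (ρ.comp f).rep.IsIrreducible := by
  rw [isIrreducible_iff] at hρ ⊢
  refine ⟨hρ.1, fun A hA => hρ.2 A fun g => ?_⟩
  obtain ⟨x, rfl⟩ := hf g
  exact hA x

theorem Equivalent.mem {ρ σ : UnitaryRep G} (h : Equivalent ρ σ) :
    ∃ U ∈ intertwiners ρ σ, Uᴴ * U = 1 ∧ U * Uᴴ = 1 := by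
  obtain ⟨U, h1, h2, h3⟩ := h
  exact ⟨U, h3, h1, h2⟩

theorem Equivalent.dim_eq {ρ σ : UnitaryRep G} (h : Equivalent ρ σ) : ρ.dim = σ.dim := by
  obtain ⟨U, hU, h1, h2⟩ := h.mem
  have := congrArg Matrix.trace h1
  rw [Matrix.trace_mul_comm, h2] at this
  simp only [Matrix.trace_one, Fintype.card_fin] at this
  exact_mod_cast this.symm

theorem Equivalent.comp {ρ σ : UnitaryRep G} (h : Equivalent ρ σ) (f : H →ₜ* G) :
    Equivalent (ρ.comp f) (σ.comp f) := by
  obtain ⟨U, h1, h2, h3⟩ := h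
  exact ⟨U, h1, h2, fun g => h3 (f g)⟩

theorem Equivalent.multiplicity_left {ρ ρ' : UnitaryRep G} (h : Equivalent ρ ρ')
    (σ : UnitaryRep G) : ρ.multiplicity σ = ρ'.multiplicity σ := by
  obtain ⟨U, hU, h1, h2⟩ := h.mem
  rw [multiplicity_eq_finrank, multiplicity_eq_finrank]
  refine LinearEquiv.finrank_eq
    { toFun A := ⟨A.1 * Uᴴ, intertwiners_mul A.2 (intertwiners_star hU)⟩
      map_add' A B := Subtype.ext (Matrix.add_mul _ _ _)
      map_smul' c A := Subtype.ext (Matrix.smul_mul _ _ _)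
      invFun A := ⟨A.1 * U, intertwiners_mul A.2 hU⟩
      left_inv A := Subtype.ext ?_
      right_inv A := Subtype.ext ?_ }
  · change A.1 * Uᴴ * U = A.1
    rw [Matrix.mul_assoc, h1, Matrix.mul_one]
  · change A.1 * U * Uᴴ = A.1
    rw [Matrix.mul_assoc, h2, Matrix.mul_one]

theorem Equivalent.isIrreducible {ρ ρ' : UnitaryRep G} (h : Equivalent ρ ρ')
    (hρ : ρ.rep.IsIrreducible) : ρ'.rep.IsIrreducible := by
  obtain ⟨U, hU, h1, h2⟩ := h.mem
  rw [isIrreducible_iff] at hρ ⊢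
  refine ⟨h.dim_eq ▸ hρ.1, fun A hA => ?_⟩
  obtain ⟨c, hc⟩ := hρ.2 _ (intertwiners_mul (intertwiners_star hU) (intertwiners_mul hA hU))
  refine ⟨c, ?_⟩
  calc A = (U * Uᴴ) * A * (U * Uᴴ) := by rw [h2, Matrix.one_mul, Matrix.mul_one]
    _ = U * (Uᴴ * (A * U)) * Uᴴ := by simp only [Matrix.mul_assoc]
    _ = c • 1 := by rw [hc, Matrix.mul_smul, Matrix.smul_mul, Matrix.mul_one, h2]

/-! ### Schur's lemma -/

/-- By Schur, `Aᴴ * A` is a scalar. It equals the squared norm `r` of a column of `A`, hence is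
positive, and dividing `A` by `√r` gives an isometry. -/
theorem exists_isometry {ρ σ : UnitaryRep G} (hρ : ρ.rep.IsIrreducible)
    {A : Matrix (Fin σ.dim) (Fin ρ.dim) ℂ} (hA : A ∈ intertwiners ρ σ) (hA0 : A ≠ 0) :
    ∃ U ∈ intertwiners ρ σ, Uᴴ * U = 1 := by
  rw [isIrreducible_iff] at hρ
  obtain ⟨c, hc⟩ := hρ.2 _ (intertwiners_mul (intertwiners_star hA) hA)
  let i : Fin ρ.dim := ⟨0, hρ.1⟩
  let r : ℝ := ∑ j, Complex.normSq (A j i)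
  have hcr : c = r := by
    have := congrFun (congrFun hc i) i
    rw [Matrix.smul_apply, Matrix.one_apply_eq, smul_eq_mul, mul_one, Matrix.mul_apply] at this
    rw [← this, Complex.ofReal_sum]
    refine Finset.sum_congr rfl fun j _ => ?_
    rw [Complex.normSq_eq_conj_mul_self]; rfl
  have hr : 0 < r := by
    refine lt_of_le_of_ne (Finset.sum_nonneg fun j _ => Complex.normSq_nonneg _) fun h0 => hA0 ?_
    rw [← Matrix.conjTranspose_mul_self_eq_zero, hc, hcr, ← h0]
    simp
  refine ⟨((Real.sqrt r)⁻¹ : ℂ) • A, Submodule.smul_mem _ _ hA, ?_⟩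
  rw [conjTranspose_smul, Matrix.smul_mul, Matrix.mul_smul, hc, hcr, smul_smul, smul_smul]
  have : star ((Real.sqrt r : ℂ)⁻¹) = ((Real.sqrt r : ℂ)⁻¹) := by
    rw [star_inv₀, Complex.star_def, Complex.conj_ofReal]
  have h2 : (Real.sqrt r : ℂ)⁻¹ * ((Real.sqrt r : ℂ)⁻¹ * (r : ℂ)) = 1 := by
    rw [← mul_assoc, ← mul_inv, ← Complex.ofReal_mul, Real.mul_self_sqrt hr.le]
    exact inv_mul_cancel₀ (by exact_mod_cast hr.ne')
  rw [this, mul_assoc, h2, one_smul]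

theorem equivalent_of_intertwiner {ρ ρ' : UnitaryRep G} (hρ : ρ.rep.IsIrreducible)
    (hρ' : ρ'.rep.IsIrreducible) {A : Matrix (Fin ρ'.dim) (Fin ρ.dim) ℂ}
    (hA : A ∈ intertwiners ρ ρ') (hA0 : A ≠ 0) : Equivalent ρ ρ' := by
  obtain ⟨U, hU, h1⟩ := exists_isometry hρ hA hA0
  refine ⟨U, h1, ?_, hU⟩
  obtain ⟨c, hc⟩ := (isIrreducible_iff.1 hρ').2 _ (intertwiners_mul hU (intertwiners_star hU))
  have h2 : (c • (1 : Matrix (Fin ρ.dim) (Fin ρ.dim) ℂ)) = 1 := by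
    calc (c • (1 : Matrix (Fin ρ.dim) (Fin ρ.dim) ℂ)) =
            Uᴴ * (c • (1 : Matrix (Fin ρ'.dim) (Fin ρ'.dim) ℂ)) * U := by
          rw [Matrix.mul_smul, Matrix.smul_mul, Matrix.mul_one, h1]
      _ = (Uᴴ * U) * (Uᴴ * U) := by rw [← hc]; simp only [Matrix.mul_assoc]
      _ = 1 := by rw [h1, Matrix.mul_one]
  have h3 := congrFun (congrFun h2 ⟨0, (isIrreducible_iff.1 hρ).1⟩) ⟨0, (isIrreducible_iff.1 hρ).1⟩
  simp only [Matrix.smul_apply, Matrix.one_apply_eq, smul_eq_mul, mul_one] at h3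
  rw [hc, h3, one_smul]

theorem multiplicity_pos_iff_equivalent {ρ ρ' : UnitaryRep G} (hρ : ρ.rep.IsIrreducible)
    (hρ' : ρ'.rep.IsIrreducible) : 0 < ρ.multiplicity ρ' ↔ Equivalent ρ ρ' := by
  rw [multiplicity_pos_iff]
  constructor
  · rintro ⟨A, hA, hA0⟩
    exact equivalent_of_intertwiner hρ hρ' hA hA0
  · intro h
    obtain ⟨U, hU, h1, h2⟩ := h.mem
    refine ⟨U, hU, ?_⟩
    rintro rfl
    have := congrFun (congrFun h1 ⟨0, (isIrreducible_iff.1 hρ).1⟩) ⟨0, (isIrreducible_iff.1 hρ).1⟩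
    simp at this

theorem ne_zero_of_isometry {ρ σ : UnitaryRep G} (hρ : 0 < ρ.dim)
    {U : Matrix (Fin σ.dim) (Fin ρ.dim) ℂ} (hU : Uᴴ * U = 1) : U ≠ 0 := by
  rintro rfl
  have := congrFun (congrFun hU ⟨0, hρ⟩) ⟨0, hρ⟩
  simp at this

/-! ### Complete reducibility -/

/-- A nonzero subrepresentation of least dimension is irreducible: an eigenspace of a
self-intertwiner is again a subrepresentation, so by minimality it is everything and the intertwiner
is scalar. -/
theorem exists_irreducible {σ : UnitaryRep G} (hσ : 0 < σ.dim) :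
    ∃ ρ : UnitaryRep G, ρ.rep.IsIrreducible ∧ ∃ U ∈ intertwiners ρ σ, Uᴴ * U = 1 := by
  classical
  let p : ℕ → Prop := fun n => ∃ τ : UnitaryRep G, τ.dim = n ∧ 0 < τ.dim ∧
    ∃ U ∈ intertwiners τ σ, Uᴴ * U = 1
  have hp : ∃ n, p n := ⟨σ.dim, σ, rfl, hσ, 1, one_mem_intertwiners σ, by simp⟩
  obtain ⟨τ, hn, h0, U, hU, hUU⟩ := Nat.find_spec hp
  refine ⟨τ, ?_, U, hU, hUU⟩
  rw [isIrreducible_iff]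
  refine ⟨h0, fun A hA => ?_⟩
  have : Nonempty (Fin τ.dim) := ⟨⟨0, h0⟩⟩
  obtain ⟨c, hc⟩ := Module.End.exists_eigenvalue (Matrix.toLin' A)
  obtain ⟨v, hv⟩ := hc.exists_hasEigenvector
  have hv1 : A *ᵥ v = c • v := by simpa using hv.apply_eq_smul
  obtain ⟨κ, V, hV, hVi, hBV, hker⟩ := exists_kernel
    (Submodule.sub_mem _ hA (Submodule.smul_mem _ c (one_mem_intertwiners τ)))
  have hκ : 0 < κ.dim := by
    by_contra h
    have hz : κ.dim = 0 := by omega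
    have : IsEmpty (Fin κ.dim) := by rw [hz]; infer_instance
    have hVz : V * Vᴴ = 0 := by ext i j; simp [Matrix.mul_apply]
    apply hv.2
    rw [← hker v (by rw [Matrix.sub_mulVec, hv1, Matrix.smul_mulVec, Matrix.one_mulVec, sub_self]),
      hVz, Matrix.zero_mulVec]
  obtain ⟨κ', V', hs⟩ := exists_complement hV hVi
  have hle : Nat.find hp ≤ κ.dim := Nat.find_min' hp ⟨κ, rfl, hκ, U * V, intertwiners_mul hU hVi, by
    rw [conjTranspose_mul, Matrix.mul_assoc, ← Matrix.mul_assoc Uᴴ, hUU, Matrix.one_mul, hV]⟩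
  have hz : κ'.dim = 0 := by have := hs.dim_eq; omega
  have : IsEmpty (Fin κ'.dim) := by rw [hz]; infer_instance
  have hV'z : V' * V'ᴴ = 0 := by ext i j; simp [Matrix.mul_apply]
  have h1 : V * Vᴴ = 1 := by have := hs.sum; rwa [hV'z, add_zero] at this
  refine ⟨c, sub_eq_zero.1 ?_⟩
  calc A - c • 1 = (A - c • 1) * (V * Vᴴ) := by rw [h1, Matrix.mul_one]
    _ = 0 := by rw [← Matrix.mul_assoc, hBV, Matrix.zero_mul]

theorem exists_isSum_irreducible {σ : UnitaryRep G} (hσ : 0 < σ.dim) :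
    ∃ (ρ κ : UnitaryRep G) (U : Matrix (Fin σ.dim) (Fin ρ.dim) ℂ)
      (V : Matrix (Fin σ.dim) (Fin κ.dim) ℂ), ρ.rep.IsIrreducible ∧ IsSum σ ρ κ U V := by
  obtain ⟨ρ, hρ, U, hU, h1⟩ := exists_irreducible hσ
  obtain ⟨κ, V, h⟩ := exists_complement h1 hU
  exact ⟨ρ, κ, U, V, hρ, h⟩

theorem multiplicity_eq_zero_of_dim {ρ σ : UnitaryRep G} (h : σ.dim = 0) :
    ρ.multiplicity σ = 0 := by
  by_contra h0
  obtain ⟨A, -, hA0⟩ := multiplicity_pos_iff.1 (Nat.pos_of_ne_zero h0)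
  have : IsEmpty (Fin σ.dim) := by rw [h]; infer_instance
  exact hA0 (by ext i; exact isEmptyElim i)

/-- A unitary representation is determined by the multiplicities of the irreducible ones. -/
theorem equivalent_of_multiplicity {σ σ' : UnitaryRep G}
    (h : ∀ ρ : UnitaryRep G, ρ.rep.IsIrreducible → ρ.multiplicity σ = ρ.multiplicity σ') :
    Equivalent σ σ' := by
  induction hn : σ.dim using Nat.strong_induction_on generalizing σ σ' with
  | _ n ih =>
    by_cases h0 : σ.dim = 0
    · have h0' : σ'.dim = 0 := by
        by_contra h1
        obtain ⟨ρ, hρ, U, hU, hUU⟩ := exists_irreducible (Nat.pos_of_ne_zero h1)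
        have := multiplicity_pos_iff.2 ⟨U, hU, ne_zero_of_isometry (isIrreducible_iff.1 hρ).1 hUU⟩
        rw [← h ρ hρ, multiplicity_eq_zero_of_dim h0] at this
        exact this.false
      have e1 : IsEmpty (Fin σ.dim) := by rw [h0]; infer_instance
      have e2 : IsEmpty (Fin σ'.dim) := by rw [h0']; infer_instance
      refine ⟨0, ?_, ?_, fun g => ?_⟩ <;> ext i <;> exact isEmptyElim i
    · obtain ⟨ρ, κ, U, V, hρ, hs⟩ := exists_isSum_irreducible (Nat.pos_of_ne_zero h0)
      have hρ0 := (isIrreducible_iff.1 hρ).1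
      have hpos : 0 < ρ.multiplicity σ' := by
        rw [← h ρ hρ]
        exact multiplicity_pos_iff.2 ⟨U, hs.memU, ne_zero_of_isometry hρ0 hs.UU⟩
      obtain ⟨A, hA, hA0⟩ := multiplicity_pos_iff.1 hpos
      obtain ⟨U', hU', hUU'⟩ := exists_isometry hρ hA hA0
      obtain ⟨κ', V', hs'⟩ := exists_complement hUU' hU'
      obtain ⟨W, hW, hW1, hW2⟩ := (ih κ.dim (by have := hs.dim_eq; omega) (σ := κ) (σ' := κ')
        (fun τ hτ => by
          have := h τ hτ
          rw [hs.multiplicity, hs'.multiplicity] at this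
          omega) rfl).mem
      -- The unitary matches the two copies of `ρ` and uses the inductive equivalence `W` on their
      -- complements.
      refine ⟨U' * Uᴴ + V' * (W * Vᴴ), ?_, ?_, Submodule.add_mem _
        (intertwiners_mul hU' (intertwiners_star hs.memU))
        (intertwiners_mul hs'.memV (intertwiners_mul hW (intertwiners_star hs.memV)))⟩
      · simp only [conjTranspose_add, conjTranspose_mul, conjTranspose_conjTranspose,
          Matrix.add_mul, Matrix.mul_add]
        have e1 : U * U'ᴴ * (U' * Uᴴ) = U * Uᴴ := by
          rw [Matrix.mul_assoc, ← Matrix.mul_assoc U'ᴴ, hs'.UU, Matrix.one_mul]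
        have e2 : V * Wᴴ * V'ᴴ * (U' * Uᴴ) = 0 := by
          rw [Matrix.mul_assoc, ← Matrix.mul_assoc V'ᴴ, hs'.VU, Matrix.zero_mul, Matrix.mul_zero]
        have e3 : U * U'ᴴ * (V' * (W * Vᴴ)) = 0 := by
          rw [Matrix.mul_assoc, ← Matrix.mul_assoc U'ᴴ, hs'.UV, Matrix.zero_mul, Matrix.mul_zero]
        have e4 : V * Wᴴ * V'ᴴ * (V' * (W * Vᴴ)) = V * Vᴴ := by
          rw [Matrix.mul_assoc, ← Matrix.mul_assoc V'ᴴ, hs'.VV, Matrix.one_mul, Matrix.mul_assoc,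
            ← Matrix.mul_assoc Wᴴ, hW1, Matrix.one_mul]
        rw [e1, e2, e3, e4, add_zero, zero_add, hs.sum]
      · simp only [conjTranspose_add, conjTranspose_mul, conjTranspose_conjTranspose,
          Matrix.add_mul, Matrix.mul_add]
        have e1 : U' * Uᴴ * (U * U'ᴴ) = U' * U'ᴴ := by
          rw [Matrix.mul_assoc, ← Matrix.mul_assoc Uᴴ, hs.UU, Matrix.one_mul]
        have e2 : V' * (W * Vᴴ) * (U * U'ᴴ) = 0 := by
          rw [← Matrix.mul_assoc, Matrix.mul_assoc V', Matrix.mul_assoc W, hs.VU, Matrix.mul_zero,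
            Matrix.mul_zero, Matrix.zero_mul]
        have e3 : U' * Uᴴ * (V * Wᴴ * V'ᴴ) = 0 := by
          rw [Matrix.mul_assoc, Matrix.mul_assoc V, ← Matrix.mul_assoc Uᴴ, hs.UV, Matrix.zero_mul,
            Matrix.mul_zero]
        have e4 : V' * (W * Vᴴ) * (V * Wᴴ * V'ᴴ) = V' * V'ᴴ := by
          rw [Matrix.mul_assoc V', Matrix.mul_assoc W, Matrix.mul_assoc V, ← Matrix.mul_assoc Vᴴ,
            hs.VV, Matrix.one_mul, ← Matrix.mul_assoc W, hW2, Matrix.one_mul]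
        rw [e1, e2, e3, e4, add_zero, zero_add, hs'.sum]

theorem finite_constituents (σ : UnitaryRep G) :
    {c : Quotient (UnitaryRep.setoid G) | ∃ ρ : UnitaryRep G, ρ.rep.IsIrreducible ∧
      Quotient.mk _ ρ = c ∧ 0 < ρ.multiplicity σ}.Finite := by
  induction hn : σ.dim using Nat.strong_induction_on generalizing σ with
  | _ n ih =>
    by_cases h0 : σ.dim = 0
    · convert Set.finite_empty
      ext c
      simp [multiplicity_eq_zero_of_dim h0]
    · obtain ⟨ρ, κ, U, V, hρ, hs⟩ := exists_isSum_irreducible (Nat.pos_of_ne_zero h0)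
      have hρ0 := (isIrreducible_iff.1 hρ).1
      refine ((ih κ.dim (by have := hs.dim_eq; omega) κ rfl).insert (Quotient.mk _ ρ)).subset ?_
      rintro c ⟨τ, hτ, rfl, hpos⟩
      rw [hs.multiplicity] at hpos
      by_cases h1 : 0 < τ.multiplicity ρ
      · exact Or.inl (Quotient.sound ((multiplicity_pos_iff_equivalent hτ hρ).1 h1))
      · exact Or.inr ⟨τ, hτ, rfl, by omega⟩

/-- Clifford multiplicities only range over irreducible `π`. Multiplicities being additive, any
irreducible summand of `σ` in which `ρ` occurs does no worse than `σ`. -/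
theorem exists_irreducible_constituent_comp (f : H →ₜ* G) (ρ : UnitaryRep H) (σ : UnitaryRep G)
    (h : 0 < ρ.multiplicity (σ.comp f)) :
    ∃ π : UnitaryRep G, π.rep.IsIrreducible ∧ 0 < ρ.multiplicity (π.comp f) ∧
      ρ.multiplicity (π.comp f) ≤ ρ.multiplicity (σ.comp f) := by
  induction hn : σ.dim using Nat.strong_induction_on generalizing σ with
  | _ n ih =>
    have h0 : σ.dim ≠ 0 := fun h0 => by
      rw [multiplicity_eq_zero_of_dim (σ := σ.comp f) h0] at h
      exact h.false
    obtain ⟨π, κ, U, V, hπ, hs⟩ := exists_isSum_irreducible (Nat.pos_of_ne_zero h0)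
    have hπ0 := (isIrreducible_iff.1 hπ).1
    have hm := (hs.comp f).multiplicity ρ
    by_cases h1 : 0 < ρ.multiplicity (π.comp f)
    · exact ⟨π, hπ, h1, by omega⟩
    · obtain ⟨π', h1, h2, h3⟩ := ih κ.dim (by have := hs.dim_eq; omega) κ (by omega) rfl
      exact ⟨π', h1, h2, by omega⟩

/-! ### Direct sums -/

/-- The direct sum of two unitary representations. -/
def directSum (σ τ : UnitaryRep G) : UnitaryRep G :=
  ofHom (n := Fin σ.dim ⊕ Fin τ.dim) (unitaryHom
    (fun g => Matrix.fromBlocks (σ.mat g) 0 0 (τ.mat g))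
    (by simp) (fun a b => by simp [Matrix.fromBlocks_multiply])
    (fun g => by
      simp [Matrix.fromBlocks_conjTranspose, Matrix.fromBlocks_multiply, star_mat_mul_mat])
    (σ.continuous_mat.matrix_fromBlocks continuous_const continuous_const τ.continuous_mat))

theorem isSum_directSum (σ τ : UnitaryRep G) :
    IsSum (directSum σ τ) σ τ
      ((Matrix.fromRows 1 0).submatrix (Fintype.equivFin (Fin σ.dim ⊕ Fin τ.dim)).symm id)
      ((Matrix.fromRows 0 1).submatrix (Fintype.equivFin (Fin σ.dim ⊕ Fin τ.dim)).symm id) := by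
  set e := (Fintype.equivFin (Fin σ.dim ⊕ Fin τ.dim)).symm
  let P : Matrix (Fin σ.dim ⊕ Fin τ.dim) (Fin σ.dim) ℂ := Matrix.fromRows 1 0
  let Q : Matrix (Fin σ.dim ⊕ Fin τ.dim) (Fin τ.dim) ℂ := Matrix.fromRows 0 1
  have star : ∀ {a b : ℕ} (A : Matrix (Fin σ.dim ⊕ Fin τ.dim) (Fin a) ℂ)
      (B : Matrix (Fin σ.dim ⊕ Fin τ.dim) (Fin b) ℂ),
      (A.submatrix e id)ᴴ * B.submatrix e id = Aᴴ * B := fun A B => by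
    rw [conjTranspose_submatrix, Matrix.submatrix_mul_equiv, Matrix.submatrix_id_id]
  have proj : ∀ {a : ℕ} (A : Matrix (Fin σ.dim ⊕ Fin τ.dim) (Fin a) ℂ),
      A.submatrix e id * (A.submatrix e id)ᴴ = (A * Aᴴ).submatrix e e := fun A => by
    rw [conjTranspose_submatrix]
    exact Matrix.submatrix_mul_equiv _ _ _ (Equiv.refl _) _
  have inter : ∀ {a : ℕ} (A : Matrix (Fin σ.dim ⊕ Fin τ.dim) (Fin a) ℂ) 
      (M : Matrix (Fin σ.dim ⊕ Fin τ.dim) (Fin σ.dim ⊕ Fin τ.dim) ℂ) (N : Matrix (Fin a) (Fin a) ℂ),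
      A * N = M * A → A.submatrix e id * N = M.submatrix e e * A.submatrix e id :=
    fun A M N h => by
      rw [Matrix.submatrix_mul_equiv, ← h]
      exact (Matrix.submatrix_mul_equiv A N e (Equiv.refl _) id)
  refine ⟨fun g => inter P (Matrix.fromBlocks (σ.mat g) 0 0 (τ.mat g)) (σ.mat g) ?_,
    fun g => inter Q (Matrix.fromBlocks (σ.mat g) 0 0 (τ.mat g)) (τ.mat g) ?_, (star P P).trans ?_,
    (star Q Q).trans ?_, (star P Q).trans ?_, (star Q P).trans ?_, ?_⟩
  · simp [P, Matrix.fromRows_mul, Matrix.fromBlocks_mul_fromRows]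
  · simp [Q, Matrix.fromRows_mul, Matrix.fromBlocks_mul_fromRows]
  iterate 4
    simp [P, Q, Matrix.conjTranspose_fromRows_eq_fromCols_conjTranspose,
      Matrix.fromCols_mul_fromRows]
  · refine (congrArg₂ (· + ·) (proj P) (proj Q)).trans ?_
    have : P * Pᴴ + Q * Qᴴ = 1 := by
      ext (i | i) (j | j) <;> simp [P, Q, Matrix.conjTranspose_fromRows_eq_fromCols_conjTranspose,
        Matrix.one_apply]
    have h2 := congrArg (fun M => Matrix.submatrix M e e) this
    simp only [Matrix.submatrix_add, Matrix.submatrix_one_equiv] at h2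
    exact h2

/-- Direct sums with multiplicities of a finite family of unitary representations. -/
theorem exists_weightedSum {α : Type*} (s : Finset α) (w : α → ℕ) (π : α → UnitaryRep G)
    (f : H →ₜ* G) : ∃ τ : UnitaryRep G, ∀ ρ : UnitaryRep H,
      ρ.multiplicity (τ.comp f) = ∑ x ∈ s, w x * ρ.multiplicity ((π x).comp f) := by
  classical
  let Z : UnitaryRep G := ⟨0, 1⟩
  have hZ : ∀ ρ : UnitaryRep H, ρ.multiplicity (Z.comp f) = 0 := fun ρ =>
    multiplicity_eq_zero_of_dim rfl
  have hn : ∀ (σ : UnitaryRep G) (n : ℕ), ∃ τ : UnitaryRep G, ∀ ρ : UnitaryRep H,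
      ρ.multiplicity (τ.comp f) = n * ρ.multiplicity (σ.comp f) := by
    intro σ n
    induction n with
    | zero => exact ⟨Z, fun ρ => by rw [hZ, zero_mul]⟩
    | succ n ih =>
      obtain ⟨τ, hτ⟩ := ih
      exact ⟨directSum τ σ, fun ρ => by
        rw [((isSum_directSum τ σ).comp f).multiplicity, hτ, add_one_mul]⟩
  induction s using Finset.induction_on with
  | empty => exact ⟨Z, fun ρ => by rw [hZ, Finset.sum_empty]⟩
  | insert a s ha ih =>
    obtain ⟨τ, hτ⟩ := ih
    obtain ⟨τ', hτ'⟩ := hn (π a) (w a)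
    exact ⟨directSum τ' τ, fun ρ => by
      rw [((isSum_directSum τ' τ).comp f).multiplicity, hτ, hτ', Finset.sum_insert ha]⟩

end UnitaryRep
end CompactGroups

namespace CompactGroups
open MeasureTheory Matrix
open scoped ENNReal InnerProductSpace

/-! ### Finite-dimensional subrepresentations of unitary representations on Hilbert spaces -/

/-- The matrices are those of `R g` in an orthonormal basis of `W`. The conclusion keeps only what
Peter–Weyl needs: whatever `π` cannot see acts trivially on `W`. -/
theorem exists_unitaryRep_of_invariant {K : Type u} [Group K] [TopologicalSpace K]
    {E : Type*} [NormedAddCommGroup E] [InnerProductSpace ℂ E] (R : K → E →ₗᵢ[ℂ] E)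
    (h1 : ∀ v, R 1 v = v) (hmul : ∀ a b v, R (a * b) v = R a (R b v))
    (hc : ∀ v, Continuous fun g => R g v) (W : Submodule ℂ E) [FiniteDimensional ℂ W]
    (hW : ∀ g, ∀ v ∈ W, R g v ∈ W) :
    ∃ π : UnitaryRep K, ∀ g, π.mat g = 1 → ∀ v ∈ W, R g v = v := by
  let b := stdOrthonormalBasis ℂ W
  let n := Module.finrank ℂ W
  let M : K → Matrix (Fin n) (Fin n) ℂ := fun g => Matrix.of fun i j => ⟪(b i : E), R g (b j)⟫_ℂ
  have hsum : ∀ g j, R g (b j) = ∑ i, M g i j • (b i : E) := by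
    intro g j
    have := congrArg (fun w : W => (w : E)) (b.sum_repr' ⟨R g (b j), hW g _ (b j).2⟩)
    simp only [Submodule.coe_sum, Submodule.coe_smul, Submodule.coe_inner] at this
    exact this.symm
  have hon : ∀ i j, ⟪(b i : E), (b j : E)⟫_ℂ = if i = j then 1 else 0 := fun i j => by
    rw [← Submodule.coe_inner]
    exact orthonormal_iff_ite.1 b.orthonormal i j
  have hM1 : M 1 = 1 := by
    ext i j
    simp only [M, Matrix.of_apply, h1, hon, Matrix.one_apply]
  refine ⟨UnitaryRep.ofMat M hM1 ?_ ?_ ?_, ?_⟩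
  · intro a c
    ext i j
    simp only [M, Matrix.of_apply, Matrix.mul_apply]
    change _ = ∑ k, M a i k * M c k j
    rw [hmul, hsum c j, map_sum, inner_sum]
    refine Finset.sum_congr rfl fun k _ => ?_
    rw [map_smul, inner_smul_right, mul_comm]
    rfl
  · intro g
    ext i j
    rw [Matrix.mul_apply, Matrix.one_apply, ← hon i j, ← (R g).inner_map_map, hsum g j, inner_sum]
    refine Finset.sum_congr rfl fun k _ => ?_
    rw [inner_smul_right, mul_comm, Matrix.conjTranspose_apply]
    simp only [M, Matrix.of_apply]
    rw [← inner_conj_symm (R g (b i) : E)]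
    rfl
  · refine continuous_matrix fun i j => ?_
    exact continuous_const.inner (hc _)
  · intro g hg v hv
    change M g = 1 at hg
    have hb : ∀ j, R g (b j) = b j := by
      intro j
      rw [hsum, hg]
      simp [Matrix.one_apply]
    have := congrArg (fun w : W => (w : E)) (b.sum_repr' ⟨v, hv⟩)
    simp only [Submodule.coe_sum, Submodule.coe_smul, Submodule.coe_inner] at this
    rw [← this, map_sum]
    exact Finset.sum_congr rfl fun j _ => by rw [map_smul, hb]

/-! ### Operators with continuous kernel -/

section Kernel

variable {X : Type*} [TopologicalSpace X] [CompactSpace X]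
  {E : Type*} [NormedAddCommGroup E] [InnerProductSpace ℂ E]

/-- The operator `v ↦ (x ↦ ⟪Ψ x, v⟫)`. -/
def kernelOp (Ψ : C(X, E)) : E →L[ℂ] C(X, ℂ) :=
  LinearMap.mkContinuous
    { toFun v := ⟨fun x => ⟪Ψ x, v⟫_ℂ, Ψ.continuous.inner continuous_const⟩
      map_add' v w := by ext x; simp
      map_smul' c v := by ext x; simp } ‖Ψ‖ fun v => by
    rw [ContinuousMap.norm_le _ (by positivity)]
    intro x
    exact (norm_inner_le_norm _ _).trans
      (mul_le_mul_of_nonneg_right (Ψ.norm_coe_le_norm x) (norm_nonneg _))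

@[simp] theorem kernelOp_apply (Ψ : C(X, E)) (v : E) (x : X) : kernelOp Ψ v x = ⟪Ψ x, v⟫_ℂ := rfl

/-- This is Arzelà–Ascoli: on the unit ball the images are bounded by `‖Ψ‖`, and by Cauchy–Schwarz
`‖Ψ x₀ - Ψ x‖` is a common modulus of continuity at `x₀`. -/
theorem isCompactOperator_kernelOp (Ψ : C(X, E)) : IsCompactOperator (kernelOp Ψ) := by
  let e := ContinuousMap.linearIsometryBoundedOfCompact X ℂ ℂ
  let S : E →L[ℂ] BoundedContinuousFunction X ℂ :=
    e.toContinuousLinearEquiv.toContinuousLinearMap.comp (kernelOp Ψ)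
  have hS : IsCompactOperator S := by
    refine (isCompactOperator_iff_isCompact_closure_image_closedBall (𝕜₁ := ℂ)
      (S : E →ₗ[ℂ] BoundedContinuousFunction X ℂ) zero_lt_one).2 ?_
    refine BoundedContinuousFunction.arzela_ascoli (Metric.closedBall (0 : ℂ) ‖Ψ‖)
      (isCompact_closedBall _ _) _ ?_ ?_
    · rintro f x ⟨v, hv, rfl⟩
      rw [mem_closedBall_zero_iff] at hv ⊢
      exact (norm_inner_le_norm _ _).trans
        ((mul_le_mul (Ψ.norm_coe_le_norm x) hv (norm_nonneg _) (norm_nonneg _)).trans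
          (mul_one _).le)
    · intro x₀
      refine Metric.equicontinuousAt_of_continuity_modulus (fun x => ‖Ψ x₀ - Ψ x‖) ?_ _
        (Filter.Eventually.of_forall ?_)
      · have : Continuous fun x => ‖Ψ x₀ - Ψ x‖ := by fun_prop
        simpa using this.tendsto x₀
      · rintro x ⟨f, v, hv, rfl⟩
        rw [mem_closedBall_zero_iff] at hv
        change dist ⟪Ψ x₀, v⟫_ℂ ⟪Ψ x, v⟫_ℂ ≤ _
        rw [dist_eq_norm, ← inner_sub_left]
        exact (norm_inner_le_norm _ _).trans (mul_le_of_le_one_right (norm_nonneg _) hv)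
  have heq : ⇑(kernelOp Ψ) =
      ⇑(e.symm.toContinuousLinearEquiv.toContinuousLinearMap : _ →L[ℂ] C(X, ℂ)) ∘ ⇑S := by
    ext v x
    simp [S]
  rw [heq]
  exact hS.clm_comp _

end Kernel

/-! ### The Peter–Weyl theorem -/

section PeterWeyl

variable {K : Type u} [Group K] [TopologicalSpace K] [IsTopologicalGroup K] [CompactSpace K]
  [T2Space K]

/-- Take a neighbourhood `V` of 1 with `g ∉ V V⁻¹`, a bump `f` supported in `V`, and `φ x = f x * f
x⁻¹`. Being real and symmetric makes convolution by `φ` self-adjoint; the disjointness of `φ` from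
its translate is what later detects `g`. -/
theorem exists_symmetric_bump {g : K} (hg : g ≠ 1) :
    ∃ φ : C(K, ℂ), φ 1 ≠ 0 ∧ (∀ x, φ x⁻¹ = φ x) ∧ (∀ x, starRingEnd ℂ (φ x) = φ x) ∧
      ∀ y, φ (g * y) * φ y = 0 := by
  obtain ⟨V, hV, hVg⟩ := exists_nhds_split_inv (isOpen_compl_singleton.mem_nhds hg.symm)
  obtain ⟨f, hf0, hf1, -⟩ := exists_continuous_zero_one_of_isClosed (s := (interior V)ᶜ)
    (t := {(1 : K)}) isOpen_interior.isClosed_compl isClosed_singleton (by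
      rw [Set.disjoint_singleton_right, Set.notMem_compl_iff]
      exact mem_interior_iff_mem_nhds.2 hV)
  have hfV : ∀ x, f x ≠ 0 → x ∈ V := fun x hx => by
    by_contra h
    exact hx (hf0 fun h' => h (interior_subset h'))
  refine ⟨⟨fun x => ((f x * f x⁻¹ : ℝ) : ℂ), by fun_prop⟩, ?_, fun x => ?_, fun x => ?_,
    fun y => ?_⟩
  · simp [hf1 rfl]
  · simp [mul_comm]
  · simp
  · by_contra h
    simp only [ContinuousMap.coe_mk, Complex.ofReal_mul, mul_eq_zero, not_or,
      Complex.ofReal_eq_zero] at h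
    have := hVg _ (hfV _ h.1.1) _ (hfV _ h.2.1)
    simp at this

variable [MeasurableSpace K] [BorelSpace K]

/-- Square-integrable functions with respect to Haar measure. -/
abbrev HaarL2 (K : Type u) [Group K] [TopologicalSpace K] [IsTopologicalGroup K] [CompactSpace K]
    [T2Space K] [MeasurableSpace K] [BorelSpace K] := Lp ℂ 2 (Measure.haar : Measure K)

/-- Continuous functions as square-integrable ones. -/
abbrev toL2 : C(K, ℂ) →L[ℂ] HaarL2 K := ContinuousMap.toLp 2 Measure.haar ℂ

/-- The unitary action `f ↦ f (g⁻¹ ·)`. -/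
def translation (g : K) : HaarL2 K →ₗᵢ[ℂ] HaarL2 K where
  toFun f := DomMulAct.mk g⁻¹ • f
  map_add' := smul_add _
  map_smul' _ _ := smul_comm _ _ _
  norm_map' _ := DomMulAct.norm_smul_Lp _ _

theorem translation_apply (g : K) (f : HaarL2 K) : translation g f = DomMulAct.mk g⁻¹ • f := rfl

theorem translation_toL2 (g : K) (f : C(K, ℂ)) :
    translation g (toL2 f) = toL2 (f.comp ⟨fun x => g⁻¹ * x, by fun_prop⟩) := rfl

theorem translation_one (f : HaarL2 K) : translation 1 f = f := by
  rw [translation_apply, inv_one]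
  exact one_smul _ f

theorem translation_mul (a b : K) (f : HaarL2 K) :
    translation (a * b) f = translation a (translation b f) := by
  rw [translation_apply, translation_apply, translation_apply, _root_.mul_inv_rev, DomMulAct.mk_mul,
    mul_smul]

theorem continuous_translation (f : HaarL2 K) : Continuous fun g : K => translation g f := by
  have : Fact ((2 : ℝ≥0∞) ≠ ∞) := ⟨by norm_num⟩
  have : Continuous fun g : K => DomMulAct.mk g⁻¹ := DomMulAct.continuous_mk.comp continuous_inv
  exact this.smul continuous_const

theorem inner_translation_left (g : K) (f h : HaarL2 K) :
    ⟪translation g f, h⟫_ℂ = ⟪f, translation g⁻¹ h⟫_ℂ := by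
  rw [← (translation g⁻¹).inner_map_map, ← translation_mul, inv_mul_cancel, translation_one]

/-- The translates of a continuous function, as a continuous family. -/
def translates (φ : C(K, ℂ)) : C(K, HaarL2 K) where
  toFun x := translation x (toL2 φ)
  continuous_toFun := continuous_translation _

theorem translates_mul (φ : C(K, ℂ)) (g x : K) :
    translates φ (g * x) = translation g (translates φ x) := translation_mul _ _ _

/-- Convolution by `φ`. -/
def convolutionOp (φ : C(K, ℂ)) : HaarL2 K →L[ℂ] HaarL2 K :=
  toL2.comp (kernelOp (translates φ))

theorem convolutionOp_apply (φ : C(K, ℂ)) (f : HaarL2 K) :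
    convolutionOp φ f = toL2 (kernelOp (translates φ) f) := rfl

theorem isCompactOperator_convolutionOp (φ : C(K, ℂ)) : IsCompactOperator (convolutionOp φ) :=
  (isCompactOperator_kernelOp (translates φ)).clm_comp toL2

theorem convolutionOp_translation (φ : C(K, ℂ)) (g : K) (f : HaarL2 K) :
    convolutionOp φ (translation g f) = translation g (convolutionOp φ f) := by
  rw [convolutionOp_apply, convolutionOp_apply, translation_toL2]
  congr 1
  ext x
  simp only [kernelOp_apply, ContinuousMap.comp_apply, ContinuousMap.coe_mk]
  rw [translates_mul, inner_translation_left, inv_inv]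

theorem kernelOp_translates_toL2 (φ f : C(K, ℂ)) (x : K) :
    kernelOp (translates φ) (toL2 f) x =
      ∫ y, f y * starRingEnd ℂ (φ (x⁻¹ * y)) ∂Measure.haar := by
  rw [kernelOp_apply]
  change ⟪translation x (toL2 φ), _⟫_ℂ = _
  rw [translation_toL2, ContinuousMap.inner_toLp]
  rfl

/-- For continuous functions this is Fubini together with the symmetry of `φ`; density of the
continuous functions in `L²` does the rest. -/
theorem isSymmetric_convolutionOp {φ : C(K, ℂ)}
    (hφ : ∀ x, starRingEnd ℂ (φ x⁻¹) = φ x) :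
    (convolutionOp φ : HaarL2 K →ₗ[ℂ] HaarL2 K).IsSymmetric := by
  have key : ∀ f h : C(K, ℂ),
      ⟪convolutionOp φ (toL2 f), toL2 h⟫_ℂ = ⟪toL2 f, convolutionOp φ (toL2 h)⟫_ℂ := by
    intro f h
    rw [convolutionOp_apply, convolutionOp_apply, ContinuousMap.inner_toLp, ContinuousMap.inner_toLp]
    simp only [kernelOp_translates_toL2]
    have e1 : ∀ x, h x * starRingEnd ℂ (∫ y, f y * starRingEnd ℂ (φ (x⁻¹ * y)) ∂Measure.haar) =
        ∫ y, h x * (starRingEnd ℂ (f y) * φ (x⁻¹ * y)) ∂Measure.haar := fun x => by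
      rw [← integral_conj, ← integral_const_mul]
      simp
    have e2 : ∀ y, (∫ x, h x * starRingEnd ℂ (φ (y⁻¹ * x)) ∂Measure.haar) * starRingEnd ℂ (f y) =
        ∫ x, h x * (starRingEnd ℂ (f y) * φ (x⁻¹ * y)) ∂Measure.haar := fun y => by
      rw [← integral_mul_const]
      refine integral_congr_ae (Filter.Eventually.of_forall fun x => ?_)
      simp only
      rw [← hφ (x⁻¹ * y)]
      simp only [_root_.mul_inv_rev, inv_inv]
      ring
    simp only [e1, e2]
    exact integral_integral_swap_of_hasCompactSupport (by fun_prop)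
      (HasCompactSupport.of_compactSpace _)
  intro f h
  have hd : DenseRange (toL2 : C(K, ℂ) →L[ℂ] HaarL2 K) :=
    ContinuousMap.toLp_denseRange ℂ Measure.haar ℂ (by norm_num)
  refine hd.induction_on (p := fun f => ∀ h, ⟪convolutionOp φ f, h⟫_ℂ = ⟪f, convolutionOp φ h⟫_ℂ) f
    ?_ ?_ h
  · simp only [Set.ofPred_forall]
    exact isClosed_iInter fun h => isClosed_eq (by fun_prop) (by fun_prop)
  · intro f h
    refine hd.induction_on h ?_ (key f)
    exact isClosed_eq (by fun_prop) (by fun_prop)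

end PeterWeyl

/-- The **Peter–Weyl theorem**: finite-dimensional unitary representations separate points. -/
theorem exists_mat_ne_one {K : Type u} [Group K] [TopologicalSpace K] [IsTopologicalGroup K]
    [CompactSpace K] [T2Space K] {g : K} (hg : g ≠ 1) : ∃ π : UnitaryRep K, π.mat g ≠ 1 := by
  by_contra! hall
  borelize K
  obtain ⟨φ, hφ1, hφs, hφr, hφg⟩ := exists_symmetric_bump hg
  let T := convolutionOp φ
  have hT : IsCompactOperator T := isCompactOperator_convolutionOp φ
  have hTs : (T : HaarL2 K →ₗ[ℂ] HaarL2 K).IsSymmetric :=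
    isSymmetric_convolutionOp fun x => by rw [hφr, hφs]
  -- An eigenspace with nonzero eigenvalue is finite-dimensional and translation-invariant, so by
  -- assumption `g` acts trivially on it. The kernel of `T` may be infinite-dimensional, but there
  -- both sides vanish.
  have hfix : ∀ c : ℂ, ∀ v ∈ Module.End.eigenspace (T : Module.End ℂ (HaarL2 K)) c,
      T (translation g v) = T v := by
    intro c v hv
    by_cases hc : c = 0
    · have hv0 : T v = 0 := by
        rw [Module.End.mem_eigenspace_iff, hc, zero_smul] at hv
        exact hv
      change convolutionOp φ _ = _
      rw [convolutionOp_translation]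
      change translation g (T v) = T v
      rw [hv0, map_zero]
    · have : FiniteDimensional ℂ (Module.End.eigenspace (T : Module.End ℂ (HaarL2 K)) c) :=
        ContinuousLinearMap.finite_dimensional_eigenspace hT c hc
      obtain ⟨π, hπ⟩ := exists_unitaryRep_of_invariant (K := K) translation translation_one
        translation_mul continuous_translation
        (Module.End.eigenspace (T : Module.End ℂ (HaarL2 K)) c) (by
          intro a w hw
          rw [Module.End.mem_eigenspace_iff] at hw ⊢
          exact (convolutionOp_translation φ a w).trans
            ((congrArg _ hw).trans (map_smul (translation a) c w)))
      rw [hπ g (hall π) v hv]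
  -- By the spectral theorem for compact self-adjoint operators the eigenspaces span a dense
  -- subspace.
  have htop : ∀ v, T (translation g v) = T v := by
    let D : HaarL2 K →L[ℂ] HaarL2 K := T.comp (translation g).toContinuousLinearMap - T
    have hle : (⨆ c, Module.End.eigenspace (T : Module.End ℂ (HaarL2 K)) c).topologicalClosure ≤
        LinearMap.ker (D : HaarL2 K →ₗ[ℂ] HaarL2 K) := by
      refine Submodule.topologicalClosure_minimal _ (iSup_le fun c v hv => ?_) D.isClosed_ker
      rw [LinearMap.mem_ker]
      exact sub_eq_zero.2 (hfix c v hv)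
    rw [Submodule.topologicalClosure_eq_top_iff.2
      (ContinuousLinearMap.orthogonalComplement_iSup_eigenspaces_eq_bot hT hTs)] at hle
    intro v
    exact sub_eq_zero.1 (hle (Submodule.mem_top (x := v)))
  -- Evaluating at 1 the continuous representatives of `T (translation g φ) = T φ` gives `∫ φ(y) φ(g
  -- y) = ∫ φ(y)²`. The left side is zero by the choice of `φ`, the right side is positive.
  have h1 := htop (toL2 φ)
  change convolutionOp φ _ = convolutionOp φ _ at h1
  rw [convolutionOp_translation, convolutionOp_apply, translation_toL2] at h1
  have h2 := ContinuousMap.toLp_injective (p := 2) (𝕜 := ℂ) (Measure.haar : Measure K) h1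
  have h3 := DFunLike.congr_fun h2 1
  simp only [ContinuousMap.comp_apply, ContinuousMap.coe_mk, mul_one,
    kernelOp_translates_toL2, inv_inv, inv_one, one_mul, hφr] at h3
  have h4 : ∫ y, φ y * φ (g * y) ∂Measure.haar = 0 := by
    simp_rw [mul_comm (φ _) (φ (g * _)), hφg]
    simp
  rw [h4] at h3
  have h5 : ∀ y, φ y * φ y = ((‖φ y‖ ^ 2 : ℝ) : ℂ) := fun y => by
    conv_lhs => rw [← hφr y, hφr y]
    nth_rw 1 [← hφr y]
    rw [mul_comm, Complex.mul_conj, Complex.normSq_eq_norm_sq]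
  simp_rw [h5] at h3
  rw [integral_complex_ofReal] at h3
  have h6 : 0 < ∫ y, ‖φ y‖ ^ 2 ∂(Measure.haar : Measure K) := by
    refine Continuous.integral_pos_of_hasCompactSupport_nonneg_nonzero (x := 1) (by fun_prop)
      (HasCompactSupport.of_compactSpace _) (fun y => by positivity) ?_
    simpa using hφ1
  exact h6.ne (by exact_mod_cast h3)

end CompactGroups

namespace CompactGroups
open MeasureTheory Matrix
open scoped ENNReal InnerProductSpace Kronecker

/-! ### Restrictions of representations -/

section Restriction

variable {K : Type u} [Group K] [TopologicalSpace K] {H : Type u} [Group H] [TopologicalSpace H]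

/-- Matrix coefficients, along `k`, of unitary representations. -/
def coefficients (k : H →ₜ* K) : Set C(H, ℂ) :=
  {f | ∃ (π : UnitaryRep K) (a b : Fin π.dim), ∀ x, f x = π.mat (k x) a b}

theorem mem_coefficients_of_hom {k : H →ₜ* K} {n : Type*} [Fintype n] [DecidableEq n]
    (f : K →ₜ* Matrix.unitaryGroup n ℂ) (a b : n) {c : C(H, ℂ)}
    (hc : ∀ x, c x = (f (k x) : Matrix n n ℂ) a b) : c ∈ coefficients k :=
  ⟨UnitaryRep.ofHom f, Fintype.equivFin n a, Fintype.equivFin n b, fun x => by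
    rw [hc, UnitaryRep.mat_ofHom]
    exact (congrArg₂ _ ((Fintype.equivFin n).symm_apply_apply a).symm
      ((Fintype.equivFin n).symm_apply_apply b).symm)⟩

theorem one_mem_coefficients (k : H →ₜ* K) : (1 : C(H, ℂ)) ∈ coefficients k :=
  mem_coefficients_of_hom (n := Unit) 1 () () fun x => by simp

theorem mul_mem_coefficients {k : H →ₜ* K} {f f' : C(H, ℂ)} (hf : f ∈ coefficients k)
    (hf' : f' ∈ coefficients k) : f * f' ∈ coefficients k := by
  obtain ⟨π, a, b, h⟩ := hf
  obtain ⟨π', a', b', h'⟩ := hf'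
  refine mem_coefficients_of_hom (n := Fin π.dim × Fin π'.dim) (UnitaryRep.unitaryHom
    (fun g => π.mat g ⊗ₖ π'.mat g) (by simp) (fun x y => by simp [Matrix.mul_kronecker_mul])
    (fun g => ?_) ?_) (a, a') (b, b') fun x => ?_
  · rw [Matrix.conjTranspose_kronecker, ← Matrix.mul_kronecker_mul, UnitaryRep.star_mat_mul_mat,
      UnitaryRep.star_mat_mul_mat, Matrix.one_kronecker_one]
  · refine continuous_matrix fun i j => ?_
    exact (π.continuous_mat.matrix_elem _ _).mul (π'.continuous_mat.matrix_elem _ _)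
  · rw [ContinuousMap.mul_apply, h, h']; rfl

theorem star_mem_coefficients {k : H →ₜ* K} {f : C(H, ℂ)} (hf : f ∈ coefficients k) :
    star f ∈ coefficients k := by
  obtain ⟨π, a, b, h⟩ := hf
  have hmul : ∀ {l m n : ℕ} (A : Matrix (Fin l) (Fin m) ℂ) (B : Matrix (Fin m) (Fin n) ℂ),
      (A * B).map (starRingEnd ℂ) = A.map (starRingEnd ℂ) * B.map (starRingEnd ℂ) :=
    fun A B => Matrix.map_mul
  have hone : (1 : Matrix (Fin π.dim) (Fin π.dim) ℂ).map (starRingEnd ℂ) = 1 :=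
    Matrix.map_one _ (map_zero _) (map_one _)
  refine mem_coefficients_of_hom (n := Fin π.dim) (UnitaryRep.unitaryHom
    (fun g => (π.mat g).map (starRingEnd ℂ)) (by rw [UnitaryRep.mat_one, hone])
    (fun x y => by rw [UnitaryRep.mat_mul, hmul]) (fun g => ?_) ?_) a b fun x => ?_
  · have : ((π.mat g).map (starRingEnd ℂ))ᴴ = ((π.mat g)ᴴ).map (starRingEnd ℂ) := rfl
    rw [this, ← hmul, UnitaryRep.star_mat_mul_mat, hone]
  · exact π.continuous_mat.matrix_map Complex.continuous_conj
  · rw [ContinuousMap.star_apply, h]; rfl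

/-- The star algebra of representative functions. -/
def representativeFunctions (k : H →ₜ* K) : StarSubalgebra ℂ C(H, ℂ) where
  carrier := Submodule.span ℂ (coefficients k)
  add_mem' := Submodule.add_mem _
  mul_mem' {f f'} hf hf' := by
    have h := Submodule.mul_mem_mul hf hf'
    rw [Submodule.span_mul_span] at h
    refine Submodule.span_mono ?_ h
    rintro _ ⟨a, ha, b, hb, rfl⟩
    exact mul_mem_coefficients ha hb
  algebraMap_mem' c := by
    rw [Algebra.algebraMap_eq_smul_one]
    exact Submodule.smul_mem _ _ (Submodule.subset_span (one_mem_coefficients k))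
  star_mem' {f} hf := by
    induction hf using Submodule.span_induction with
    | mem f hf => exact Submodule.subset_span (star_mem_coefficients hf)
    | zero => rw [star_zero]; exact Submodule.zero_mem _
    | add f f' _ _ h h' => rw [star_add]; exact Submodule.add_mem _ h h'
    | smul c f _ h => rw [star_smul]; exact Submodule.smul_mem _ _ h

variable [IsTopologicalGroup K] [CompactSpace K] [T2Space K]

/-- Stone–Weierstrass: since `k` is injective, Peter–Weyl for `K` already separates the points of
`H`. -/
theorem representativeFunctions_topologicalClosure [CompactSpace H] {k : H →ₜ* K}
    (hk : Injective k) : (representativeFunctions k).topologicalClosure = ⊤ := by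
  refine ContinuousMap.starSubalgebra_topologicalClosure_eq_top_of_separatesPoints _ ?_
  intro x y hxy
  obtain ⟨π, hπ⟩ := exists_mat_ne_one (g := k (x⁻¹ * y)) fun h =>
    hxy (inv_mul_eq_one.1 (hk (h.trans (map_one k).symm)))
  have hne : π.mat (k x) ≠ π.mat (k y) := fun h => hπ (by
    rw [map_mul, UnitaryRep.mat_mul, ← h, ← UnitaryRep.mat_mul, ← map_mul, inv_mul_cancel,
      map_one, UnitaryRep.mat_one])
  obtain ⟨a, b, hab⟩ : ∃ a b, π.mat (k x) a b ≠ π.mat (k y) a b := by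
    by_contra! h
    exact hne (Matrix.ext h)
  exact ⟨_, ⟨⟨fun x => π.mat (k x) a b,
    (π.continuous_mat.comp k.continuous_toFun).matrix_elem a b⟩,
    Submodule.subset_span ⟨π, a, b, fun _ => rfl⟩, rfl⟩, hab⟩

variable [IsTopologicalGroup H] [CompactSpace H] [T2Space H]

/-- The matrix is the Haar average of `σ(x) E ρ(x)ᴴ` for the matrix unit `E` at `(b, d)`; left
invariance of the measure makes it an intertwiner. -/
theorem averaged_mem_intertwiners [MeasurableSpace H] [BorelSpace H] (ρ σ : UnitaryRep H)
    (b : Fin σ.dim) (d : Fin ρ.dim) :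
    (Matrix.of fun i j => ∫ x, σ.mat x i b * starRingEnd ℂ (ρ.mat x j d) ∂Measure.haar) ∈
      UnitaryRep.intertwiners ρ σ := by
  have cσ : ∀ i j, Continuous fun x => σ.mat x i j := fun i j => σ.continuous_mat.matrix_elem i j
  have cρ : ∀ i j, Continuous fun x => ρ.mat x i j := fun i j => ρ.continuous_mat.matrix_elem i j
  have hint : ∀ f : H → ℂ, Continuous f → Integrable f (Measure.haar : Measure H) := fun f hf =>
    hf.integrable_of_hasCompactSupport (HasCompactSupport.of_compactSpace _)
  intro x
  ext i j
  rw [Matrix.mul_apply, Matrix.mul_apply]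
  simp only [Matrix.of_apply]
  calc ∑ l, (∫ y, σ.mat y i b * starRingEnd ℂ (ρ.mat y l d) ∂Measure.haar) * ρ.mat x l j
      = ∫ y, σ.mat y i b * starRingEnd ℂ (ρ.mat (x⁻¹ * y) j d) ∂Measure.haar := by
        simp_rw [← integral_mul_const]
        rw [← integral_finsetSum _ fun l _ => hint _ (by fun_prop)]
        refine integral_congr_ae (Filter.Eventually.of_forall fun y => ?_)
        simp only
        rw [UnitaryRep.mat_mul, Matrix.mul_apply, map_sum, Finset.mul_sum]
        refine Finset.sum_congr rfl fun l _ => ?_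
        have : starRingEnd ℂ (ρ.mat x⁻¹ j l) = ρ.mat x l j := by
          rw [← UnitaryRep.star_mat, Matrix.conjTranspose_apply]
          exact star_star _
        rw [map_mul, this]
        ring
    _ = ∫ y, σ.mat (x * y) i b * starRingEnd ℂ (ρ.mat y j d) ∂Measure.haar := by
        rw [← integral_mul_left_eq_self _ x]
        simp
    _ = ∑ l, σ.mat x i l * ∫ y, σ.mat y l b * starRingEnd ℂ (ρ.mat y j d) ∂Measure.haar := by
        simp_rw [← integral_const_mul]
        rw [← integral_finsetSum _ fun l _ => hint _ (by fun_prop)]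
        refine integral_congr_ae (Filter.Eventually.of_forall fun y => ?_)
        simp only
        rw [UnitaryRep.mat_mul, Matrix.mul_apply, Finset.sum_mul]
        exact Finset.sum_congr rfl fun l _ => mul_assoc _ _ _

/-- Every irreducible representation of a closed subgroup occurs in a restriction. -/
theorem exists_multiplicity_comp_pos {k : H →ₜ* K} (hk : Injective k) {ρ : UnitaryRep H}
    (hρ : ρ.rep.IsIrreducible) : ∃ π : UnitaryRep K, 0 < ρ.multiplicity (π.comp k) := by
  by_contra! hall
  borelize H
  have cρ : ∀ i j, Continuous fun x => ρ.mat x i j := fun i j => ρ.continuous_mat.matrix_elem i j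
  let d : Fin ρ.dim := ⟨0, (UnitaryRep.isIrreducible_iff.1 hρ).1⟩
  -- If `ρ` occurs in no restriction, all averaged intertwiners vanish, so every coefficient along
  -- `k` is orthogonal to the coefficients of `ρ`. These coefficients span a dense subspace, so
  -- those of `ρ` are orthogonal to themselves.
  have hzero : ∀ j, ∫ x, ρ.mat x j d * starRingEnd ℂ (ρ.mat x j d) ∂Measure.haar = 0 := by
    intro j
    let r : C(H, ℂ) := ⟨fun x => ρ.mat x j d, cρ j d⟩
    let L : C(H, ℂ) →L[ℂ] ℂ := (innerSL ℂ (toL2 r)).comp toL2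
    have hL : ∀ f, L f = ∫ x, f x * starRingEnd ℂ (ρ.mat x j d) ∂Measure.haar := fun f =>
      ContinuousMap.inner_toLp _ _ _
    have hle : Submodule.span ℂ (coefficients k) ≤ LinearMap.ker (L : C(H, ℂ) →ₗ[ℂ] ℂ) := by
      rw [Submodule.span_le]
      rintro f ⟨π, a, b, hf⟩
      rw [SetLike.mem_coe, LinearMap.mem_ker]
      change L f = 0
      rw [hL]
      simp only [hf]
      have hA := averaged_mem_intertwiners ρ (π.comp k) b d
      by_contra hne
      exact (hall π).not_gt (UnitaryRep.multiplicity_pos_iff.2 ⟨_, hA, fun h0 =>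
        hne (congrFun (congrFun h0 a) j)⟩)
    have hr : r ∈ (representativeFunctions k).topologicalClosure := by
      rw [representativeFunctions_topologicalClosure hk]; trivial
    have : r ∈ LinearMap.ker (L : C(H, ℂ) →ₗ[ℂ] ℂ) :=
      closure_minimal (s := (Submodule.span ℂ (coefficients k) : Set C(H, ℂ))) hle L.isClosed_ker hr
    exact (hL r).symm.trans this
  -- The column `d` of a unitary matrix has norm 1, so the vanishing integrals add up to the total
  -- mass of Haar measure.
  have hone : ∀ x, ∑ j, ρ.mat x j d * starRingEnd ℂ (ρ.mat x j d) = 1 := fun x => by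
    have := congrFun (congrFun (ρ.star_mat_mul_mat x) d) d
    rw [Matrix.mul_apply, Matrix.one_apply_eq] at this
    rw [← this]
    exact Finset.sum_congr rfl fun j _ => mul_comm _ _
  have h1 : ∫ _ : H, (1 : ℂ) ∂Measure.haar = 0 := by
    rw [show (fun _ : H => (1 : ℂ)) = fun x => ∑ j, ρ.mat x j d * starRingEnd ℂ (ρ.mat x j d) from
      funext fun x => (hone x).symm, integral_finsetSum]
    · exact Finset.sum_eq_zero fun j _ => hzero j
    · exact fun j _ => Continuous.integrable_of_hasCompactSupport (by fun_prop)
        (HasCompactSupport.of_compactSpace _)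
  rw [integral_const] at h1
  simp only [smul_eq_zero, one_ne_zero, or_false] at h1
  rw [measureReal_eq_zero_iff] at h1
  exact (isOpen_univ.measure_pos Measure.haar Set.univ_nonempty).ne' h1

end Restriction

end CompactGroups

namespace CompactGroups
open Matrix

/-! ### Clifford theory -/

namespace UnitaryRep

variable {G H : Type u} [Group G] [TopologicalSpace G] [Group H] [TopologicalSpace H]

/-- `V` intertwines `σ ∘ ψ` with `σ`. Hence maps `ρ ∘ ψ → σ` correspond to maps `ρ ∘ ψ → σ ∘ ψ`,
which are the maps `ρ → σ` because `ψ` is onto. -/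
theorem multiplicity_comp_of_surjective (ρ : UnitaryRep H) {σ : UnitaryRep H} {ψ : H →ₜ* H}
    (hψ : Surjective ψ) {V : Matrix (Fin σ.dim) (Fin σ.dim) ℂ} (h1 : Vᴴ * V = 1)
    (h2 : V * Vᴴ = 1) (hV : ∀ x, V * σ.mat (ψ x) = σ.mat x * V) :
    (ρ.comp ψ).multiplicity σ = ρ.multiplicity σ := by
  have hV' : ∀ x, Vᴴ * σ.mat x = σ.mat (ψ x) * Vᴴ := fun x => by
    calc Vᴴ * σ.mat x = Vᴴ * (σ.mat x * V) * Vᴴ := by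
          rw [Matrix.mul_assoc, Matrix.mul_assoc, h2, Matrix.mul_one]
      _ = σ.mat (ψ x) * Vᴴ := by rw [← hV, ← Matrix.mul_assoc, h1, Matrix.one_mul]
  have key : ∀ (B : Matrix (Fin σ.dim) (Fin ρ.dim) ℂ) (x : H),
      B * ρ.mat (ψ x) = σ.mat x * B → Vᴴ * B * ρ.mat (ψ x) = σ.mat (ψ x) * (Vᴴ * B) :=
    fun B x hB => by
      rw [Matrix.mul_assoc, hB, ← Matrix.mul_assoc, hV', Matrix.mul_assoc]
  have key' : ∀ (A : Matrix (Fin σ.dim) (Fin ρ.dim) ℂ) (x : H),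
      A * ρ.mat (ψ x) = σ.mat (ψ x) * A → V * A * ρ.mat (ψ x) = σ.mat x * (V * A) :=
    fun A x hA => by
      rw [Matrix.mul_assoc, hA, ← Matrix.mul_assoc, hV, Matrix.mul_assoc]
  rw [multiplicity_eq_finrank, multiplicity_eq_finrank]
  refine LinearEquiv.finrank_eq
    { toFun B := ⟨Vᴴ * B.1, fun y => ?_⟩
      map_add' A B := Subtype.ext (Matrix.mul_add _ _ _)
      map_smul' c A := Subtype.ext (Matrix.mul_smul _ _ _)
      invFun A := ⟨V * A.1, fun x => ?_⟩
      left_inv A := Subtype.ext ?_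
      right_inv A := Subtype.ext ?_ }
  · obtain ⟨x, rfl⟩ := hψ y
    exact key B.1 x (B.2 x)
  · exact key' A.1 x (A.2 (ψ x))
  · change V * (Vᴴ * A.1) = A.1
    rw [← Matrix.mul_assoc, h2, Matrix.one_mul]
  · change Vᴴ * (V * A.1) = A.1
    rw [← Matrix.mul_assoc, h1, Matrix.one_mul]

theorem eq_bot_or_eq_top_of_isIrreducible {π : UnitaryRep G} (hπ : π.rep.IsIrreducible)
    (W : Submodule ℂ (Fin π.dim → ℂ)) (hW : ∀ g, ∀ v ∈ W, π.mat g *ᵥ v ∈ W) :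
    W = ⊥ ∨ W = ⊤ := by
  have := hπ
  rcases eq_bot_or_eq_top (⟨W, fun g v hv => hW g v hv⟩ : Subrepresentation π.rep) with h | h
  · exact Or.inl (congrArg Subrepresentation.toSubmodule h)
  · exact Or.inr (congrArg Subrepresentation.toSubmodule h)

/-- The vectors killed by all `B * π.mat g` form an invariant subspace. If it contained the columns
of `A`, it would be everything, forcing `B = 0`. -/
theorem exists_mul_mat_mul_ne_zero {π : UnitaryRep G} (hπ : π.rep.IsIrreducible) {m n : ℕ}
    {A : Matrix (Fin π.dim) (Fin m) ℂ} {B : Matrix (Fin n) (Fin π.dim) ℂ} (hA : A ≠ 0)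
    (hB : B ≠ 0) : ∃ g, B * π.mat g * A ≠ 0 := by
  by_contra! hall
  let S : Submodule ℂ (Fin π.dim → ℂ) :=
    { carrier := {v | ∀ g, (B * π.mat g) *ᵥ v = 0}
      add_mem' := fun hv hw g => by rw [Matrix.mulVec_add, hv g, hw g, add_zero]
      zero_mem' := fun g => Matrix.mulVec_zero _
      smul_mem' := fun c v hv g => by rw [Matrix.mulVec_smul, hv g, smul_zero] }
  have hAS : ∀ w, A *ᵥ w ∈ S := fun w g => by
    rw [Matrix.mulVec_mulVec, hall, Matrix.zero_mulVec]
  rcases eq_bot_or_eq_top_of_isIrreducible hπ S (fun g v hv g' => by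
    rw [Matrix.mulVec_mulVec, Matrix.mul_assoc, ← mat_mul]; exact hv _) with h | h
  · refine hA (Matrix.ext_of_mulVec_single fun j => ?_)
    have := hAS (Pi.single j 1)
    rw [h, Submodule.mem_bot] at this
    rw [this, Matrix.zero_mulVec]
  · refine hB (Matrix.ext_of_mulVec_single fun j => ?_)
    have : Pi.single j 1 ∈ S := by rw [h]; trivial
    have := this 1
    rw [mat_one, Matrix.mul_one] at this
    rw [this, Matrix.zero_mulVec]

end UnitaryRep

open UnitaryRep

section Single

variable {H G : Type u} [Group H] [TopologicalSpace H] [CompactSpace H] [Group G]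
  [TopologicalSpace G] [IsTopologicalGroup G] [T2Space G] {ι : H →ₜ* G}

/-- Conjugation by an element of `G`, as a continuous endomorphism of `H`. -/
def conjHom (h : IsNormalEmbedding ι) (g : G) : H →ₜ* H where
  toMonoidHom := (conjAut h g).toMonoidHom
  continuous_toFun := continuous_conjAut h g

theorem conjHom_apply (h : IsNormalEmbedding ι) (g : G) (x : H) :
    conjHom h g x = conjAut h g x := rfl

theorem surjective_conjHom (h : IsNormalEmbedding ι) (g : G) : Surjective (conjHom h g) :=
  (conjAut h g).surjective

theorem mat_mul_mat_conjHom (h : IsNormalEmbedding ι) (π : UnitaryRep G) (g : G) (x : H) :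
    π.mat g⁻¹ * π.mat (ι (conjHom h g x)) = π.mat (ι x) * π.mat g⁻¹ := by
  rw [← mat_mul, ← mat_mul, conjHom_apply, map_conjAut]
  group

theorem multiplicity_conjHom (h : IsNormalEmbedding ι) (ρ : UnitaryRep H) (π : UnitaryRep G)
    (g : G) :
    (ρ.comp (conjHom h g)).multiplicity (π.comp ι) = ρ.multiplicity (π.comp ι) :=
  multiplicity_comp_of_surjective ρ (surjective_conjHom h g) (π.star_mat_mul_mat g⁻¹)
    (π.mat_mul_star_mat g⁻¹) (mat_mul_mat_conjHom h π g)

/-- **Clifford's theorem**: the constituents of the restriction of an irreducible representation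
to a normal subgroup are conjugate. -/
theorem exists_equivalent_conjHom (h : IsNormalEmbedding ι) {π : UnitaryRep G}
    (hπ : π.rep.IsIrreducible) {ρ ρ' : UnitaryRep H} (hρ : ρ.rep.IsIrreducible)
    (hρ' : ρ'.rep.IsIrreducible) (hm : 0 < ρ.multiplicity (π.comp ι))
    (hm' : 0 < ρ'.multiplicity (π.comp ι)) : ∃ g, Equivalent (ρ.comp (conjHom h g)) ρ' := by
  obtain ⟨(A : Matrix (Fin π.dim) (Fin ρ.dim) ℂ), hA, hA0⟩ := multiplicity_pos_iff.1 hm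
  obtain ⟨(B : Matrix (Fin π.dim) (Fin ρ'.dim) ℂ), hB, hB0⟩ := multiplicity_pos_iff.1 hm'
  have hB0' : Bᴴ ≠ 0 := fun h0 => hB0 (Matrix.conjTranspose_eq_zero.1 h0)
  -- Irreducibility of `π` lets some `π.mat g` connect the copy of `ρ` to that of `ρ'`; the
  -- compression `Bᴴ * π.mat g * A` then intertwines the conjugate of `ρ` by `g⁻¹` with `ρ'`.
  obtain ⟨g, hg⟩ := exists_mul_mat_mul_ne_zero hπ hA0 hB0'
  refine ⟨g⁻¹, equivalent_of_intertwiner (isIrreducible_comp hρ (surjective_conjHom h _)) hρ'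
    (A := Bᴴ * π.mat g * A) (fun x => ?_) hg⟩
  have e1 : A * ρ.mat (conjHom h g⁻¹ x) = π.mat (ι (conjHom h g⁻¹ x)) * A := hA _
  have e2 : Bᴴ * π.mat (ι x) = ρ'.mat x * Bᴴ := intertwiners_star hB x
  have e3 := mat_mul_mat_conjHom h π g⁻¹ x
  rw [inv_inv] at e3
  calc Bᴴ * π.mat g * A * ρ.mat (conjHom h g⁻¹ x)
      = Bᴴ * (π.mat g * π.mat (ι (conjHom h g⁻¹ x)) * A) := by
        simp only [Matrix.mul_assoc, e1]
    _ = (Bᴴ * π.mat (ι x)) * (π.mat g * A) := by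
        rw [e3]; simp only [Matrix.mul_assoc]
    _ = ρ'.mat x * (Bᴴ * π.mat g * A) := by
        rw [e2]; simp only [Matrix.mul_assoc]

/-- A finite conjugation-stable set of classes of irreducible representations is the support of
the restriction of a representation of `G` all of whose multiplicities are a prescribed one. -/
theorem exists_rep_multiplicity_eq (h : IsNormalEmbedding ι)
    (C : Finset (Quotient (UnitaryRep.setoid H))) (hirr : ∀ c ∈ C, c.out.rep.IsIrreducible)
    (hC : ∀ ρ : UnitaryRep H, Quotient.mk _ ρ ∈ C → ∀ g,
      (Quotient.mk _ (ρ.comp (conjHom h g)) : Quotient (UnitaryRep.setoid H)) ∈ C) (M : ℕ)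
    (hM : ∀ c ∈ C, ∃ π : UnitaryRep G, π.rep.IsIrreducible ∧ 0 < c.out.multiplicity (π.comp ι) ∧
      c.out.multiplicity (π.comp ι) ≤ M) :
    ∃ τ : UnitaryRep G, ∀ ρ : UnitaryRep H, ρ.rep.IsIrreducible →
      (Quotient.mk _ ρ ∈ C → ρ.multiplicity (τ.comp ι) = (M * C.card).factorial) ∧
      (Quotient.mk _ ρ ∉ C → ρ.multiplicity (τ.comp ι) = 0) := by
  classical
  have : Nonempty (UnitaryRep G) := ⟨⟨0, 1⟩⟩
  choose! π hπ hpos hle using hM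
  let m : Quotient (UnitaryRep.setoid H) → ℕ := fun c => c.out.multiplicity ((π c).comp ι)
  -- By Clifford's theorem `O c` is the orbit of `c` under `G`, and the constituents of `π c` along
  -- it all have multiplicity `m c`.
  let O : Quotient (UnitaryRep.setoid H) → Finset (Quotient (UnitaryRep.setoid H)) := fun c =>
    C.filter fun c' => 0 < c'.out.multiplicity ((π c).comp ι)
  have hout : ∀ c : Quotient (UnitaryRep.setoid H), Quotient.mk _ c.out = c := Quotient.out_eq
  have hrel : ∀ c ∈ C, ∀ c' ∈ C, (0 < c'.out.multiplicity ((π c).comp ι) ↔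
      ∃ g, Equivalent (c.out.comp (conjHom h g)) c'.out) := by
    intro c hc c' hc'
    constructor
    · exact fun h' => exists_equivalent_conjHom h (hπ c hc) (hirr c hc) (hirr c' hc') (hpos c hc) h'
    · rintro ⟨g, hg⟩
      rw [← hg.multiplicity_left, multiplicity_conjHom]
      exact hpos c hc
  have hmult : ∀ c ∈ C, ∀ c' ∈ C, 0 < c'.out.multiplicity ((π c).comp ι) →
      c'.out.multiplicity ((π c).comp ι) = m c := by
    intro c hc c' hc' h'
    obtain ⟨g, hg⟩ := (hrel c hc c' hc').1 h'
    rw [← hg.multiplicity_left, multiplicity_conjHom]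
  have hcomp : ∀ (ρ : UnitaryRep H) (a b : G), (ρ.comp (conjHom h a)).comp (conjHom h b) =
      ρ.comp (conjHom h (a * b)) := fun ρ a b => by
    refine congrArg (fun f : H →ₜ* H => ρ.comp f)
      (DFunLike.ext ((conjHom h a).comp (conjHom h b)) _ fun x => ?_)
    change conjAut h a (conjAut h b x) = conjAut h (a * b) x
    rw [map_mul]; rfl
  have hone : ∀ ρ : UnitaryRep H, ρ.comp (conjHom h 1) = ρ := fun ρ => by
    refine congrArg (fun f : H →ₜ* H => ρ.comp f)
      (DFunLike.ext (conjHom h 1) (ContinuousMonoidHom.id H) fun x => ?_)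
    change conjAut h 1 x = x
    rw [map_one]; rfl
  have hsymm : ∀ c ∈ C, ∀ c' ∈ C, 0 < c'.out.multiplicity ((π c).comp ι) →
      0 < c.out.multiplicity ((π c').comp ι) := by
    intro c hc c' hc' h'
    obtain ⟨g, hg⟩ := (hrel c hc c' hc').1 h'
    refine (hrel c' hc' c hc).2 ⟨g⁻¹, ?_⟩
    have := hg.comp (conjHom h g⁻¹)
    rw [hcomp, mul_inv_cancel, hone] at this
    exact (UnitaryRep.setoid H).symm this
  have htrans : ∀ c ∈ C, ∀ c' ∈ C, 0 < c'.out.multiplicity ((π c).comp ι) → O c' ⊆ O c := by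
    intro c hc c' hc' h' d hd
    rw [Finset.mem_filter] at hd ⊢
    refine ⟨hd.1, (hrel c hc d hd.1).2 ?_⟩
    obtain ⟨a, ha⟩ := (hrel c hc c' hc').1 h'
    obtain ⟨b, hb⟩ := (hrel c' hc' d hd.1).1 hd.2
    refine ⟨a * b, ?_⟩
    rw [← hcomp]
    exact (UnitaryRep.setoid H).trans (ha.comp _) hb
  have hOeq : ∀ c ∈ C, ∀ c' ∈ C, 0 < c'.out.multiplicity ((π c).comp ι) → O c' = O c :=
    fun c hc c' hc' h' => (htrans c hc c' hc' h').antisymm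
      (htrans c' hc' c hc (hsymm c hc c' hc' h'))
  let N := (M * C.card).factorial
  have hOpos : ∀ c ∈ C, 0 < (O c).card := fun c hc =>
    Finset.card_pos.2 ⟨c, Finset.mem_filter.2 ⟨hc, hpos c hc⟩⟩
  -- The factorial is divisible by every possible `m c * (O c).card`, while depending only on `M`
  -- and `C` and not on `G`. This is what later makes one value serve all `G i`.
  have hdvd : ∀ c ∈ C, m c * (O c).card ∣ N := fun c hc =>
    Nat.dvd_factorial (Nat.mul_pos (hpos c hc) (hOpos c hc))
      (Nat.mul_le_mul (hle c hc) (Finset.card_filter_le _ _))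
  -- The chosen `π c` may differ along one orbit. With these weights each `c` in the orbit of `c₀`
  -- contributes `N / (O c₀).card` to the multiplicity of `c₀`, for a total of `N`.
  obtain ⟨τ, hτ⟩ := exists_weightedSum C (fun c => N / (m c * (O c).card)) π ι
  refine ⟨τ, fun ρ hρ => ⟨fun hmem => ?_, fun hmem => ?_⟩⟩
  · set c₀ : Quotient (UnitaryRep.setoid H) := Quotient.mk _ ρ with hc₀
    have heq : Equivalent ρ c₀.out := Quotient.exact (hout c₀).symm
    rw [heq.multiplicity_left, hτ]
    calc ∑ c ∈ C, N / (m c * (O c).card) * c₀.out.multiplicity ((π c).comp ι)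
        = ∑ c ∈ O c₀, N / (O c₀).card := by
          rw [Finset.sum_filter]
          refine Finset.sum_congr rfl fun c hc => ?_
          split_ifs with h'
          · have h'' := hsymm _ hmem _ hc h'
            rw [hmult c hc c₀ hmem h'', hOeq c₀ hmem c hc h', Nat.mul_comm (m c), ← Nat.div_div_eq_div_mul]
            refine Nat.div_mul_cancel ?_
            have := hdvd c hc
            rw [hOeq c₀ hmem c hc h', Nat.mul_comm] at this
            exact Nat.dvd_div_of_mul_dvd this
          · have : c₀.out.multiplicity ((π c).comp ι) = 0 := by
              by_contra h0
              exact h' (hsymm c hc c₀ hmem (Nat.pos_of_ne_zero h0))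
            rw [this, mul_zero]
      _ = N := by
          rw [Finset.sum_const, smul_eq_mul]
          exact Nat.mul_div_cancel' ((Dvd.intro_left _ rfl).trans (hdvd c₀ hmem))
  · rw [hτ]
    refine Finset.sum_eq_zero fun c hc => ?_
    by_contra h0
    obtain ⟨g, hg⟩ := exists_equivalent_conjHom h (hπ c hc) (hirr c hc) hρ (hpos c hc)
      (Nat.pos_of_ne_zero (right_ne_zero_of_mul h0))
    refine hmem ?_
    rw [← Quotient.sound (s := UnitaryRep.setoid H) hg]
    exact hC _ (by rwa [hout]) g

end Single

end CompactGroups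

/-! ### Clifford multiplicities and the finiteness condition -/

namespace CompactGroups
open Matrix UnitaryRep

section Multiplicity

variable {H G : Type u} [Group H] [TopologicalSpace H] [Group G] [TopologicalSpace G]
  {ι : H →ₜ* G}

theorem cliffordMultiplicity_le {ρ : UnitaryRep H} (π : UnitaryRep G) (h : 0 < ρ.multiplicity (π.comp ι)) :
    cliffordMultiplicity ι ρ ≤ (ρ.multiplicity (π.comp ι) : ℕ∞) := by
  obtain ⟨π', hπ', h0, hle⟩ := exists_irreducible_constituent_comp ι ρ π h
  have h1 : cliffordMultiplicity ι ρ ≤ (ρ.multiplicity (π'.comp ι) : ℕ∞) :=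
    sInf_le ⟨π', hπ', rfl, by exact_mod_cast h0⟩
  exact h1.trans (by exact_mod_cast hle)

theorem exists_multiplicity_eq_cliffordMultiplicity {ρ : UnitaryRep H}
    (h : cliffordMultiplicity ι ρ < ⊤) :
    ∃ π : UnitaryRep G, π.rep.IsIrreducible ∧ 0 < ρ.multiplicity (π.comp ι) ∧
      (ρ.multiplicity (π.comp ι) : ℕ∞) = cliffordMultiplicity ι ρ := by
  have hne : {m : ℕ∞ | ∃ π : UnitaryRep G, π.rep.IsIrreducible ∧
      m = (ρ.multiplicity (π.comp ι) : ℕ∞) ∧ 0 < m}.Nonempty := by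
    by_contra hne
    rw [Set.not_nonempty_iff_eq_empty] at hne
    rw [cliffordMultiplicity, hne, sInf_empty] at h
    exact h.false
  obtain ⟨π, hπ, he, h0⟩ := csInf_mem hne
  exact ⟨π, hπ, by rw [he] at h0; exact_mod_cast h0, he.symm⟩

/-- A representation whose restriction is equivalent to `κ` has a conjugate extending `κ`. -/
theorem exists_extension_of_equivalent {σ : UnitaryRep G} {κ : UnitaryRep H}
    (h : Equivalent (σ.comp ι) κ) :
    ∃ j : G →ₜ* Matrix.unitaryGroup (Fin κ.dim) ℂ, j.comp ι = κ.toHom := by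
  obtain ⟨(U : Matrix (Fin κ.dim) (Fin σ.dim) ℂ), hU1, hU2, hU3⟩ := h
  have hU1' : Uᴴ * U = (1 : Matrix (Fin σ.dim) (Fin σ.dim) ℂ) := hU1
  have hU3' : ∀ x, U * σ.mat (ι x) = κ.mat x * U := hU3
  refine ⟨unitaryHom (fun g => U * σ.mat g * Uᴴ) ?_ ?_ ?_ ?_, ?_⟩
  · rw [mat_one, Matrix.mul_one]; exact hU2
  · intro a b
    calc U * σ.mat (a * b) * Uᴴ = U * σ.mat a * (Uᴴ * U) * σ.mat b * Uᴴ := by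
          rw [hU1', Matrix.mul_one, mat_mul]; simp only [Matrix.mul_assoc]
      _ = U * σ.mat a * Uᴴ * (U * σ.mat b * Uᴴ) := by simp only [Matrix.mul_assoc]
  · intro g
    rw [conjTranspose_mul, conjTranspose_mul, conjTranspose_conjTranspose]
    calc U * ((σ.mat g)ᴴ * Uᴴ) * (U * σ.mat g * Uᴴ)
        = U * ((σ.mat g)ᴴ * (Uᴴ * U) * σ.mat g) * Uᴴ := by simp only [Matrix.mul_assoc]
      _ = 1 := by
          rw [hU1', Matrix.mul_one, star_mat_mul_mat, Matrix.mul_one]; exact hU2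
  · exact (continuous_const.matrix_mul σ.continuous_mat).matrix_mul continuous_const
  · refine DFunLike.ext _ _ fun x => Subtype.ext ?_
    change U * σ.mat (ι x) * Uᴴ = κ.mat x
    rw [hU3', Matrix.mul_assoc]
    exact (congrArg _ hU2).trans (Matrix.mul_one _)

end Multiplicity

section Family

variable {I : Type u} {H : Type u} {G : I → Type u}
  [Group H] [TopologicalSpace H] [CompactSpace H]
  [∀ i, Group (G i)] [∀ i, TopologicalSpace (G i)] [∀ i, IsTopologicalGroup (G i)]
  [∀ i, T2Space (G i)] {ι : ∀ i, H →ₜ* G i}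

theorem surjective_coprodEnd (h : ∀ i, IsNormalEmbedding (ι i)) (γ : Monoid.CoprodI G) :
    Surjective (coprodEnd h γ) := (coprodAut h γ).surjective

/-- Compatible morphisms to a compact group which are injective on `H` force condition `FIN`. -/
theorem FIN_of_compatible [IsTopologicalGroup H] [T2Space H]
    (h : ∀ i, IsNormalEmbedding (ι i)) {K : Type u} [Group K]
    [TopologicalSpace K] [IsTopologicalGroup K] [CompactSpace K] [T2Space K] {k : H →ₜ* K}
    (hk : Injective k) (f : ∀ i, G i →ₜ* K) (hf : ∀ i, (f i).comp (ι i) = k) : FIN h := by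
  intro ρ hρ
  obtain ⟨π, hπ⟩ := exists_multiplicity_comp_pos hk hρ
  let F : Monoid.CoprodI G →* K := Monoid.CoprodI.lift fun i => (f i).toMonoidHom
  -- Inside `K` the action of the free product on `H` becomes conjugation by `F γ`.
  have hF : ∀ γ x, F γ * k x = k (coprodAut h γ x) * F γ := by
    intro γ
    induction γ using Monoid.CoprodI.induction_on with
    | one => intro x; simp
    | of i g =>
      intro x
      have e1 : F (Monoid.CoprodI.of g) = f i g := Monoid.CoprodI.lift_of _ _
      have e2 : coprodAut h (Monoid.CoprodI.of g) = conjAut (h i) g :=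
        Monoid.CoprodI.lift_of _ _
      have e3 : ∀ y, k y = f i (ι i y) := fun y => by rw [← hf i]; rfl
      rw [e1, e2, e3, e3, map_conjAut, ← map_mul, ← map_mul]
      group
    | mul a b ha hb =>
      intro x
      rw [map_mul, map_mul, mul_assoc, hb, ← mul_assoc, ha, mul_assoc]
      rfl
  constructor
  · refine (finite_constituents (π.comp k)).subset ?_
    rintro _ ⟨γ, rfl⟩
    refine ⟨_, isIrreducible_comp hρ (surjective_coprodEnd h γ⁻¹), rfl, ?_⟩
    rw [multiplicity_comp_of_surjective ρ (σ := π.comp k) (surjective_coprodEnd h γ⁻¹)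
      (π.star_mat_mul_mat (F γ)) (π.mat_mul_star_mat (F γ)) fun x => ?_]
    · exact hπ
    · change π.mat (F γ) * π.mat (k _) = π.mat (k x) * π.mat (F γ)
      rw [← mat_mul, ← mat_mul, hF]
      change π.mat (k (coprodAut h γ (coprodAut h γ⁻¹ x)) * _) = _
      rw [map_inv, MulAut.apply_inv_self]
  -- Pulled back to each `G i`, the single `π` gives a bound that does not depend on `i`.
  · refine lt_of_le_of_lt (iSup_le fun i => ?_) (ENat.natCast_lt_top (ρ.multiplicity (π.comp k)))
    have e : (π.comp (f i)).comp (ι i) = π.comp k := by rw [← hf i]; rfl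
    have := cliffordMultiplicity_le (ι := ι i) (ρ := ρ) (π.comp (f i)) (by rwa [e])
    rwa [e] at this

/-- Under condition `FIN`, every irreducible representation of `H` occurs in the common
restriction of representations of the `G i`. -/
theorem exists_compatible_of_FIN {h : ∀ i, IsNormalEmbedding (ι i)} (hFIN : FIN h) [Nonempty I]
    {ρ : UnitaryRep H} (hρ : ρ.rep.IsIrreducible) :
    ∃ (n : ℕ) (k : H →ₜ* Matrix.unitaryGroup (Fin n) ℂ)
      (j : ∀ i, G i →ₜ* Matrix.unitaryGroup (Fin n) ℂ),
      (∀ i, (j i).comp (ι i) = k) ∧ ∀ x, k x = 1 → ρ.mat x = 1 := by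
  classical
  let C := (hFIN ρ hρ).1.toFinset
  have hCmem : ∀ c, c ∈ C ↔ c ∈ cliffordClass h ρ := fun c => Set.Finite.mem_toFinset _
  have hirr : ∀ c ∈ C, c.out.rep.IsIrreducible := by
    intro c hc
    obtain ⟨γ, rfl⟩ := (hCmem c).1 hc
    have he : Equivalent (ρ.comp (coprodEnd h γ⁻¹)) (Quotient.out (Quotient.mk _ _)) :=
      Quotient.exact (Quotient.out_eq (s := UnitaryRep.setoid H)
        (Quotient.mk _ (ρ.comp (coprodEnd h γ⁻¹)))).symm
    exact he.isIrreducible (isIrreducible_comp hρ (surjective_coprodEnd h γ⁻¹))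
  have hstable : ∀ i, ∀ σ : UnitaryRep H, Quotient.mk _ σ ∈ C → ∀ g,
      (Quotient.mk _ (σ.comp (conjHom (h i) g)) : Quotient (UnitaryRep.setoid H)) ∈ C := by
    intro i σ hσ g
    obtain ⟨γ, hγ⟩ := (hCmem _).1 hσ
    have he : Equivalent (ρ.comp (coprodEnd h γ⁻¹)) σ := Quotient.exact hγ
    -- The inverse appears because precomposition with conjugation by `g` is the action of `g⁻¹`.
    refine (hCmem _).2 ⟨(Monoid.CoprodI.of g)⁻¹ * γ, ?_⟩
    refine Quotient.sound (s := UnitaryRep.setoid H) ?_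
    have e : ρ.comp (coprodEnd h ((Monoid.CoprodI.of g)⁻¹ * γ)⁻¹) =
        (ρ.comp (coprodEnd h γ⁻¹)).comp (conjHom (h i) g) := by
      refine congrArg (fun f : H →ₜ* H => ρ.comp f)
        (DFunLike.ext _ ((coprodEnd h γ⁻¹).comp (conjHom (h i) g)) fun x => ?_)
      change coprodAut h ((Monoid.CoprodI.of g)⁻¹ * γ)⁻¹ x = coprodAut h γ⁻¹ (conjAut (h i) g x)
      have e2 : coprodAut h (Monoid.CoprodI.of g) = conjAut (h i) g :=
        Monoid.CoprodI.lift_of _ _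
      rw [_root_.mul_inv_rev, inv_inv, map_mul, e2]
      rfl
    rw [e]
    exact he.comp _
  -- A bound uniform both in `i` and in the class; the sum over `C` is a number only because `C` is
  -- finite.
  let M := ∑ c ∈ C, (familyCliffordMultiplicity ι c.out).toNat
  have hM : ∀ i, ∀ c ∈ C, ∃ π : UnitaryRep (G i), π.rep.IsIrreducible ∧
      0 < c.out.multiplicity (π.comp (ι i)) ∧ c.out.multiplicity (π.comp (ι i)) ≤ M := by
    intro i c hc
    have hlt := (hFIN c.out (hirr c hc)).2
    have hle : cliffordMultiplicity (ι i) c.out ≤ familyCliffordMultiplicity ι c.out :=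
      le_iSup (fun i => cliffordMultiplicity (ι i) c.out) i
    obtain ⟨π, hπ, h0, he⟩ := exists_multiplicity_eq_cliffordMultiplicity (hle.trans_lt hlt)
    refine ⟨π, hπ, h0, le_trans ?_ (Finset.single_le_sum
      (f := fun c : Quotient (UnitaryRep.setoid H) => (familyCliffordMultiplicity ι c.out).toNat)
      (fun _ _ => Nat.zero_le _) hc)⟩
    rw [← he, ← ENat.natCast_toNat hlt.ne] at hle
    exact_mod_cast hle
  choose τ hτ using fun i => exists_rep_multiplicity_eq (h i) C hirr (hstable i) M (hM i)
  let i₀ : I := Classical.arbitrary I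
  let κ : UnitaryRep H := (τ i₀).comp (ι i₀)
  -- All restrictions have the same multiplicities, so they are equivalent to `κ`; conjugating each
  -- by its equivalence makes them literally equal to `κ`.
  have heq : ∀ i, Equivalent ((τ i).comp (ι i)) κ := fun i =>
    equivalent_of_multiplicity fun σ hσ => by
      by_cases hmem : Quotient.mk _ σ ∈ C
      · rw [(hτ i σ hσ).1 hmem, (hτ i₀ σ hσ).1 hmem]
      · rw [(hτ i σ hσ).2 hmem, (hτ i₀ σ hσ).2 hmem]
  choose j hj using fun i => exists_extension_of_equivalent (heq i)
  refine ⟨κ.dim, κ.toHom, j, hj, ?_⟩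
  · intro x hx
    have hmem : Quotient.mk _ ρ ∈ C := (hCmem _).2 ⟨1, congrArg _ (by
      refine congrArg (fun f : H →ₜ* H => ρ.comp f)
        (DFunLike.ext (coprodEnd h 1⁻¹) (ContinuousMonoidHom.id H) fun x => ?_)
      change coprodAut h 1⁻¹ x = x
      simp)⟩
    have hpos : 0 < ρ.multiplicity κ := by
      rw [(hτ i₀ ρ hρ).1 hmem]; exact Nat.factorial_pos _
    obtain ⟨A, hA, hA0⟩ := multiplicity_pos_iff.1 hpos
    obtain ⟨W, hW, hWW⟩ := exists_isometry hρ hA hA0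
    have hx' : κ.mat x = 1 := congrArg Subtype.val hx
    calc ρ.mat x = Wᴴ * (W * ρ.mat x) := by rw [← Matrix.mul_assoc, hWW, Matrix.one_mul]
      _ = 1 := by rw [hW x, hx', Matrix.one_mul, hWW]

end Family

/-- Irreducible representations separate points. -/
theorem exists_irreducible_mat_ne_one {K : Type u} [Group K] [TopologicalSpace K]
    [IsTopologicalGroup K] [CompactSpace K] [T2Space K] {g : K} (hg : g ≠ 1) :
    ∃ π : UnitaryRep K, π.rep.IsIrreducible ∧ π.mat g ≠ 1 := by
  obtain ⟨π, hπ⟩ := exists_mat_ne_one hg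
  induction hn : π.dim using Nat.strong_induction_on generalizing π with
  | _ n ih =>
    have h0 : π.dim ≠ 0 := fun h0 => hπ (by
      have : IsEmpty (Fin π.dim) := by rw [h0]; infer_instance
      ext i; exact isEmptyElim i)
    obtain ⟨ρ, κ, U, V, hρ, hs⟩ := exists_isSum_irreducible (Nat.pos_of_ne_zero h0)
    by_cases h1 : ρ.mat g = 1
    · refine ih κ.dim ?_ κ (fun h2 => hπ ?_) rfl
      · have := hs.dim_eq
        have := (isIrreducible_iff.1 hρ).1
        omega
      · calc π.mat g = π.mat g * (U * Uᴴ + V * Vᴴ) := by rw [hs.sum, Matrix.mul_one]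
          _ = (π.mat g * U) * Uᴴ + (π.mat g * V) * Vᴴ := by
            rw [Matrix.mul_add, Matrix.mul_assoc, Matrix.mul_assoc]
          _ = 1 := by
            rw [← hs.memU g, ← hs.memV g, h1, h2, Matrix.mul_one, Matrix.mul_one, hs.sum]
    · exact ⟨ρ, hρ, h1⟩

end CompactGroups

namespace CompactGroups
open Matrix UnitaryRep

/-! ### Free products of compact groups -/

section UnitaryHoms

variable {K : Type u} [Group K] [TopologicalSpace K]
  {n m : Type*} [Fintype n] [DecidableEq n] [Fintype m] [DecidableEq m]

/-- Block sum of homomorphisms to unitary groups. -/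
def sumHom (f : K →ₜ* Matrix.unitaryGroup n ℂ) (f' : K →ₜ* Matrix.unitaryGroup m ℂ) :
    K →ₜ* Matrix.unitaryGroup (n ⊕ m) ℂ :=
  unitaryHom (fun g => Matrix.fromBlocks (f g : Matrix n n ℂ) 0 0 (f' g : Matrix m m ℂ))
    (by simp) (fun a b => by simp [Matrix.fromBlocks_multiply])
    (fun g => by
      have h : (f g : Matrix n n ℂ)ᴴ * (f g : Matrix n n ℂ) = 1 :=
        Matrix.mem_unitaryGroup_iff'.1 (f g).2
      have h' : (f' g : Matrix m m ℂ)ᴴ * (f' g : Matrix m m ℂ) = 1 :=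
        Matrix.mem_unitaryGroup_iff'.1 (f' g).2
      simp [Matrix.fromBlocks_conjTranspose, Matrix.fromBlocks_multiply, h, h'])
    ((continuous_subtype_val.comp f.continuous_toFun).matrix_fromBlocks continuous_const
      continuous_const (continuous_subtype_val.comp f'.continuous_toFun))

theorem sumHom_apply (f : K →ₜ* Matrix.unitaryGroup n ℂ) (f' : K →ₜ* Matrix.unitaryGroup m ℂ)
    (g : K) : (sumHom f f' g : Matrix (n ⊕ m) (n ⊕ m) ℂ) =
      Matrix.fromBlocks (f g : Matrix n n ℂ) 0 0 (f' g : Matrix m m ℂ) := rfl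

/-- Reindexing of a homomorphism to a unitary group. -/
def reindexHom (e : m ≃ n) (f : K →ₜ* Matrix.unitaryGroup n ℂ) :
    K →ₜ* Matrix.unitaryGroup m ℂ :=
  unitaryHom (fun g => (f g : Matrix n n ℂ).submatrix e e) (by simp)
    (fun a b => by simp [Matrix.submatrix_mul_equiv])
    (fun g => by
      have h : (f g : Matrix n n ℂ)ᴴ * (f g : Matrix n n ℂ) = 1 :=
        Matrix.mem_unitaryGroup_iff'.1 (f g).2
      rw [Matrix.conjTranspose_submatrix, Matrix.submatrix_mul_equiv, h,
        Matrix.submatrix_one_equiv])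
    ((continuous_subtype_val.comp f.continuous_toFun).matrix_submatrix _ _)

theorem reindexHom_apply (e : m ≃ n) (f : K →ₜ* Matrix.unitaryGroup n ℂ) (g : K) (a b : m) :
    (reindexHom e f g : Matrix m m ℂ) a b = (f g : Matrix n n ℂ) (e a) (e b) := rfl

/-- Conjugation of a homomorphism to a unitary group by a Hermitian involution. -/
def conjugateHom (W : Matrix n n ℂ) (hW : Wᴴ = W) (hW2 : W * W = 1)
    (f : K →ₜ* Matrix.unitaryGroup n ℂ) : K →ₜ* Matrix.unitaryGroup n ℂ :=
  unitaryHom (fun g => W * (f g : Matrix n n ℂ) * W) (by simp [hW2])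
    (fun a b => by
      calc W * ((f (a * b) : Matrix.unitaryGroup n ℂ) : Matrix n n ℂ) * W
          = W * (f a : Matrix n n ℂ) * (1 * ((f b : Matrix n n ℂ) * W)) := by
            rw [map_mul, Matrix.one_mul]
            simp only [Matrix.UnitaryGroup.mul_val, Matrix.mul_assoc]
        _ = _ := by rw [← hW2]; simp only [Matrix.mul_assoc])
    (fun g => by
      have h : (f g : Matrix n n ℂ)ᴴ * (f g : Matrix n n ℂ) = 1 :=
        Matrix.mem_unitaryGroup_iff'.1 (f g).2
      rw [conjTranspose_mul, conjTranspose_mul, hW]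
      calc W * ((f g : Matrix n n ℂ)ᴴ * W) * (W * (f g : Matrix n n ℂ) * W)
          = W * (f g : Matrix n n ℂ)ᴴ * (W * W) * ((f g : Matrix n n ℂ) * W) := by
            simp only [Matrix.mul_assoc]
        _ = W * ((f g : Matrix n n ℂ)ᴴ * (f g : Matrix n n ℂ)) * W := by
            rw [hW2, Matrix.mul_one]; simp only [Matrix.mul_assoc]
        _ = 1 := by rw [h, Matrix.mul_one, hW2])
    ((continuous_const.matrix_mul (continuous_subtype_val.comp f.continuous_toFun)).matrix_mul
      continuous_const)

/-- If `π.mat g` is diagonal with an entry different from 1, adjoining a trivial summand and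
conjugating by a reflection that mixes the two coordinates produces a nonzero off-diagonal entry. -/
theorem exists_offDiagonal_ne_zero [IsTopologicalGroup K] [CompactSpace K] [T2Space K] {g : K}
    (hg : g ≠ 1) :
    ∃ (n : ℕ) (f : K →ₜ* Matrix.unitaryGroup (Fin n) ℂ) (a b : Fin n), a ≠ b ∧
      (f g : Matrix (Fin n) (Fin n) ℂ) a b ≠ 0 := by
  obtain ⟨π, hπ⟩ := exists_mat_ne_one hg
  by_cases hoff : ∃ a b, a ≠ b ∧ π.mat g a b ≠ 0
  · obtain ⟨a, b, hab, h⟩ := hoff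
    exact ⟨π.dim, π.toHom, a, b, hab, h⟩
  push Not at hoff
  obtain ⟨a, ha⟩ : ∃ a, π.mat g a a ≠ 1 := by
    by_contra! h
    refine hπ (Matrix.ext fun a b => ?_)
    by_cases hab : a = b
    · subst hab; rw [h, Matrix.one_apply_eq]
    · rw [hoff a b hab, Matrix.one_apply_ne hab]
  -- The reflection in this vector has entries ±3/5 and 4/5 on the two coordinates. With -1 in place
  -- of -2 it would merely swap them, and the matrix would stay diagonal.
  let v : Fin π.dim ⊕ Unit → ℂ := Sum.elim (Pi.single a 1) (fun _ => -2)
  have hv : v ⬝ᵥ v = 5 := by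
    simp [v, dotProduct, Fintype.sum_sum_type, Pi.single_apply]
    norm_num
  let W : Matrix (Fin π.dim ⊕ Unit) (Fin π.dim ⊕ Unit) ℂ :=
    1 - (2 / 5 : ℂ) • Matrix.vecMulVec v v
  have hvs : ∀ x, star (v x) = v x := by
    rintro (x | x)
    · simp only [v, Sum.elim_inl, Pi.single_apply]; split_ifs <;> simp
    · simp [v]
  have hW : Wᴴ = W := by
    ext x y
    simp only [W, Matrix.conjTranspose_apply, Matrix.sub_apply, Matrix.smul_apply, smul_eq_mul,
      Matrix.vecMulVec_apply, star_sub, star_mul', hvs, Matrix.one_apply, eq_comm (a := x)]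
    split_ifs <;> simp [mul_comm]
  have hW2 : W * W = 1 := by
    have : Matrix.vecMulVec v v * Matrix.vecMulVec v v = (5 : ℂ) • Matrix.vecMulVec v v := by
      rw [Matrix.vecMulVec_mul_vecMulVec, hv, Matrix.vecMulVec_smul]
    simp only [W, Matrix.sub_mul, Matrix.mul_sub, Matrix.one_mul, Matrix.mul_one,
      Matrix.smul_mul, Matrix.mul_smul, this, smul_smul]
    module
  let f := conjugateHom W hW hW2 (sumHom π.toHom (1 : K →ₜ* Matrix.unitaryGroup Unit ℂ))
  refine ⟨_, reindexHom (Fintype.equivFin (Fin π.dim ⊕ Unit)).symm f,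
    Fintype.equivFin _ (Sum.inl a), Fintype.equivFin _ (Sum.inr ()), by simp, ?_⟩
  rw [reindexHom_apply, Equiv.symm_apply_apply, Equiv.symm_apply_apply]
  have hval : (f g : Matrix (Fin π.dim ⊕ Unit) (Fin π.dim ⊕ Unit) ℂ) (Sum.inl a) (Sum.inr ()) = 12 / 25 * (π.mat g a a - 1) := by
    let B : Matrix (Fin π.dim ⊕ Unit) (Fin π.dim ⊕ Unit) ℂ := Matrix.fromBlocks (π.mat g) 0 0 1
    change (W * B * W) (Sum.inl a) (Sum.inr ()) = _
    rw [Matrix.mul_assoc, Matrix.mul_apply, Fintype.sum_sum_type]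
    simp only [Matrix.mul_apply, Fintype.sum_sum_type, W, B, v, Matrix.sub_apply, Matrix.smul_apply,
      Matrix.vecMulVec_apply, Matrix.one_apply]
    simp [Pi.single_apply, mul_sub, sub_mul, Finset.sum_sub_distrib]
    ring
  rw [hval]
  exact mul_ne_zero (by norm_num) (sub_ne_zero.2 ha)

end UnitaryHoms

/-! ### Detecting alternating words -/

section Words

variable {I : Type u} {Q : I → Type u} [∀ i, Group (Q i)] [∀ i, TopologicalSpace (Q i)]

/-- The unitary matrix by which a word acts. -/
def wordMat {n : Type*} [Fintype n] [DecidableEq n] (σ : ∀ i, Q i →ₜ* Matrix.unitaryGroup n ℂ)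
    (w : List (Σ i, Q i)) : Matrix n n ℂ :=
  ((w.map fun l => σ l.1 l.2).prod : Matrix.unitaryGroup n ℂ)

theorem wordMat_nil {n : Type*} [Fintype n] [DecidableEq n]
    (σ : ∀ i, Q i →ₜ* Matrix.unitaryGroup n ℂ) : wordMat σ [] = 1 := rfl

theorem wordMat_cons {n : Type*} [Fintype n] [DecidableEq n]
    (σ : ∀ i, Q i →ₜ* Matrix.unitaryGroup n ℂ) (l : Σ i, Q i) (w : List (Σ i, Q i)) :
    wordMat σ (l :: w) = (σ l.1 l.2 : Matrix n n ℂ) * wordMat σ w := by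
  simp [wordMat]

variable [∀ i, IsTopologicalGroup (Q i)] [∀ i, CompactSpace (Q i)] [∀ i, T2Space (Q i)]

/-- Letters act one by one on the basis vector `b`, from the right end of the word. The invariant is
that coordinate `a` stays zero until the whole word has acted. For a new letter in `Q i`, a block on
which it has a nonzero entry `(c, d)` with `c ≠ d` is adjoined, and `a` is swapped with `d` in the
representation of `Q i` alone. The swap is invisible until the new letter acts, which then carries
coordinate `a` to `c`. -/
theorem exists_wordMat_ne_zero (w : List (Σ i, Q i)) (hne : ∀ l ∈ w, l.2 ≠ 1)
    (hch : w.IsChain fun l l' => l.1 ≠ l'.1) :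
    ∃ (n : Type) (_ : Fintype n) (_ : DecidableEq n) (σ : ∀ i, Q i →ₜ* Matrix.unitaryGroup n ℂ)
      (a b : n), wordMat σ w a b ≠ 0 ∧ ∀ s, s <:+ w → s ≠ w → wordMat σ s a b = 0 := by
  classical
  induction w with
  | nil =>
    refine ⟨Unit, inferInstance, inferInstance, fun _ => 1, (), (), by simp [wordMat_nil], ?_⟩
    intro s hs hs'
    exact absurd (List.suffix_nil.1 hs) hs'
  | cons l w ih =>
    obtain ⟨i, q⟩ := l
    obtain ⟨n, _, _, σ, a, b, hab, hs⟩ := ih (fun l hl => hne l (List.mem_cons_of_mem _ hl))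
      hch.tail
    obtain ⟨m, f, c, d, hcd, hf⟩ := exists_offDiagonal_ne_zero (hne _ List.mem_cons_self)
    let S : n ⊕ Fin m ≃ n ⊕ Fin m := Equiv.swap (Sum.inl a) (Sum.inr d)
    let σ' : ∀ j, Q j →ₜ* Matrix.unitaryGroup (n ⊕ Fin m) ℂ :=
      Function.update (fun j => sumHom (σ j) 1) i (reindexHom S (sumHom (σ i) f))
    have hσi : σ' i = reindexHom S (sumHom (σ i) f) := Function.update_self _ _ _
    have hσj : ∀ j, j ≠ i → σ' j = sumHom (σ j) 1 := fun j hj => Function.update_of_ne hj _ _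
    have hSa : S (Sum.inl a) = Sum.inr d := Equiv.swap_apply_left _ _
    have hSd : S (Sum.inr d) = Sum.inl a := Equiv.swap_apply_right _ _
    have hSl : ∀ x, x ≠ a → S (Sum.inl x) = Sum.inl x := fun x hx =>
      Equiv.swap_apply_of_ne_of_ne (by simpa using hx) (by simp)
    have hSr : ∀ x, x ≠ d → S (Sum.inr x) = Sum.inr x := fun x hx =>
      Equiv.swap_apply_of_ne_of_ne (by simp) (by simpa using hx)
    have hhead : ∀ j q' t, w = ⟨j, q'⟩ :: t → j ≠ i := by
      rintro j q' t rfl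
      exact (List.isChain_cons_cons.1 hch).1.symm
    -- Up to the end of `w` the vector never leaves the old block and evolves as before.
    have key : ∀ s, s <:+ w → (∀ x, wordMat σ' s (Sum.inl x) (Sum.inl b) = wordMat σ s x b) ∧
        ∀ y, wordMat σ' s (Sum.inr y) (Sum.inl b) = 0 := by
      intro s
      induction s with
      | nil => simp [wordMat_nil, Matrix.one_apply]
      | cons l t iht =>
        intro hlt
        have ht : t <:+ w := (List.suffix_cons l t).trans hlt
        have htw : t ≠ w := by
          rintro rfl
          simpa using hlt.length_le
        obtain ⟨h1, h2⟩ := iht ht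
        have h0 : wordMat σ t a b = 0 := hs t ht htw
        have hexp : ∀ p, wordMat σ' (l :: t) p (Sum.inl b) =
            ∑ x, (σ' l.1 l.2 : Matrix (n ⊕ Fin m) (n ⊕ Fin m) ℂ) p (Sum.inl x) * wordMat σ t x b := fun p => by
          rw [wordMat_cons, Matrix.mul_apply, Fintype.sum_sum_type]
          simp [h1, h2]
        have hexp' : ∀ x, wordMat σ (l :: t) x b =
            ∑ y, (σ l.1 l.2 : Matrix n n ℂ) x y * wordMat σ t y b := fun x => by
          rw [wordMat_cons, Matrix.mul_apply]
        obtain ⟨j, q'⟩ := l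
        by_cases hj : j = i
        · subst hj
          -- The head of `w` is not in `Q i`, so a suffix starting in `Q i` is proper. Coordinate
          -- `a` is thus zero after this letter as well as before it, and the swap has no effect.
          have hlw : (⟨j, q'⟩ :: t : List (Σ i, Q i)) ≠ w := fun h => hhead j q' t h.symm rfl
          have h3 : wordMat σ (⟨j, q'⟩ :: t) a b = 0 := hs _ hlt hlw
          have hentry : ∀ p x, (σ' j q' : Matrix (n ⊕ Fin m) (n ⊕ Fin m) ℂ) p (Sum.inl x) * wordMat σ t x b =
              Matrix.fromBlocks (σ j q' : Matrix n n ℂ) 0 0 (f q' : Matrix (Fin m) (Fin m) ℂ)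
                (S p) (Sum.inl x) * wordMat σ t x b := by
            intro p x
            rw [hσi, reindexHom_apply, sumHom_apply]
            by_cases hx : x = a
            · subst hx; rw [h0, mul_zero, mul_zero]
            · rw [hSl x hx]
          constructor
          · intro x
            rw [hexp]
            simp only [hentry]
            by_cases hx : x = a
            · subst hx
              rw [h3, hSa]
              simp
            · rw [hSl x hx, hexp']
              simp
          · intro y
            rw [hexp]
            simp only [hentry]
            by_cases hy : y = d
            · subst hy
              rw [hSd, ← h3, hexp']
              simp
            · rw [hSr y hy]
              simp
        · constructor
          · intro x
            rw [hexp, hexp']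
            simp only [hσj j hj, sumHom_apply]
            simp
          · intro y
            rw [hexp]
            simp only [hσj j hj, sumHom_apply]
            simp
    refine ⟨n ⊕ Fin m, inferInstance, inferInstance, σ', Sum.inr c, Sum.inl b, ?_, ?_⟩
    · obtain ⟨h1, h2⟩ := key w List.suffix_rfl
      rw [wordMat_cons, Matrix.mul_apply, Fintype.sum_sum_type]
      simp only [h1, h2, mul_zero, Finset.sum_const_zero, add_zero]
      rw [Finset.sum_eq_single a]
      · rw [hσi, reindexHom_apply, sumHom_apply, hSa, hSr c hcd, Matrix.fromBlocks_apply₂₂]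
        exact mul_ne_zero hf hab
      · intro x _ hx
        rw [hσi, reindexHom_apply, sumHom_apply, hSl x hx, hSr c hcd, Matrix.fromBlocks_apply₂₁]
        simp
      · simp
    · intro s hsl hsne
      rcases List.suffix_cons_iff.1 hsl with h | h
      · exact absurd h hsne
      · exact (key s h).2 c

/-- Unitary representations separate the points of a free product of compact groups. -/
theorem exists_wordMat_ne_one (w : List (Σ i, Q i)) (hw : w ≠ []) (hne : ∀ l ∈ w, l.2 ≠ 1)
    (hch : w.IsChain fun l l' => l.1 ≠ l'.1) :
    ∃ (n : ℕ) (σ : ∀ i, Q i →ₜ* Matrix.unitaryGroup (Fin n) ℂ),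
      (w.map fun l => σ l.1 l.2).prod ≠ 1 := by
  obtain ⟨n, _, _, σ, a, b, hab, hs⟩ := exists_wordMat_ne_zero w hne hch
  -- The empty word is a proper suffix, so the `(a, b)` entry of the identity is zero.
  have hba : a ≠ b := by
    rintro rfl
    simpa [wordMat_nil] using hs [] List.nil_suffix hw.symm
  let e := (Fintype.equivFin n).symm
  have hmat : ∀ w, wordMat (fun i => reindexHom e (σ i)) w = (wordMat σ w).submatrix e e := by
    intro w
    induction w with
    | nil => simp [wordMat_nil]
    | cons l w ih =>
      rw [wordMat_cons, wordMat_cons, ih, ← Matrix.submatrix_mul_equiv _ _ _ e]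
      rfl
  refine ⟨_, fun i => reindexHom e (σ i), fun h => hab ?_⟩
  have h1 : wordMat (fun i => reindexHom e (σ i)) w = 1 := congrArg Subtype.val h
  have h2 := congrFun (congrFun ((hmat w).symm.trans h1) (e.symm a)) (e.symm b)
  rwa [Matrix.submatrix_apply, Equiv.apply_symm_apply, Equiv.apply_symm_apply,
    Matrix.one_apply_ne (by simpa using hba)] at h2

end Words

end CompactGroups

/-! ### Compatible families separate the points of the amalgamated product -/

namespace CompactGroups
open Matrix UnitaryRep

theorem isCompact_unitaryGroup (n : ℕ) :
    IsCompact (Matrix.unitaryGroup (Fin n) ℂ : Set (Matrix (Fin n) (Fin n) ℂ)) := by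
  have hK : IsCompact {M : Matrix (Fin n) (Fin n) ℂ |
      ∀ i, M i ∈ {x : Fin n → ℂ | ∀ j, x j ∈ Metric.closedBall (0 : ℂ) 1}} :=
    isCompact_pi_infinite fun _ => isCompact_pi_infinite fun _ => isCompact_closedBall _ _
  refine hK.of_isClosed_subset ?_ fun M hM i j => ?_
  · have : (Matrix.unitaryGroup (Fin n) ℂ : Set (Matrix (Fin n) (Fin n) ℂ)) =
        {M | Mᴴ * M = 1} := Set.ext fun M => Matrix.mem_unitaryGroup_iff'
    rw [this]
    exact isClosed_eq (by fun_prop) continuous_const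
  · rw [mem_closedBall_zero_iff]
    exact entry_norm_bound_of_unitary hM i j

instance (n : ℕ) : CompactSpace (Matrix.unitaryGroup (Fin n) ℂ) :=
  isCompact_iff_compactSpace.1 (isCompact_unitaryGroup n)

section Pushout

variable {I : Type u} {H : Type u} {G : I → Type u} [Group H] [TopologicalSpace H]
  [∀ i, Group (G i)] [∀ i, TopologicalSpace (G i)]

/-! ### Construction of the multi-pushout of compact groups -/

/-- Families of unitary representations of the `G i` with a common restriction to `H`. -/
structure CompatibleFamily (ι : ∀ i, H →ₜ* G i) : Type u where
  dim : ℕ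
  base : H →ₜ* Matrix.unitaryGroup (Fin dim) ℂ
  map : ∀ i, G i →ₜ* Matrix.unitaryGroup (Fin dim) ℂ
  comm : ∀ i, (map i).comp (ι i) = base

/-- The representation of the amalgamated product given by a compatible family. -/
def CompatibleFamily.lift {ι : ∀ i, H →ₜ* G i} (s : CompatibleFamily ι) :
    Monoid.PushoutI (fun i => (ι i).toMonoidHom) →* Matrix.unitaryGroup (Fin s.dim) ℂ :=
  Monoid.PushoutI.lift (fun i => (s.map i).toMonoidHom) s.base.toMonoidHom
    fun i => congrArg ContinuousMonoidHom.toMonoidHom (s.comm i)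

theorem fromAlgebraicPushout_of {ι : ∀ i, H →ₜ* G i} {P : Type u} [Group P] [TopologicalSpace P]
    {k : H →ₜ* P} {j : ∀ i, G i →ₜ* P} (h : ∀ i, (j i).comp (ι i) = k) (i : I) (g : G i) :
    fromAlgebraicPushout h (Monoid.PushoutI.of i g) = j i g :=
  Monoid.PushoutI.lift_of _ _ _ _

theorem fromAlgebraicPushout_base {ι : ∀ i, H →ₜ* G i} {P : Type u} [Group P]
    [TopologicalSpace P] {k : H →ₜ* P} {j : ∀ i, G i →ₜ* P} (h : ∀ i, (j i).comp (ι i) = k)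
    (x : H) : fromAlgebraicPushout h (Monoid.PushoutI.base _ x) = k x :=
  Monoid.PushoutI.lift_base _ _ _ _

theorem CompatibleFamily.lift_of {ι : ∀ i, H →ₜ* G i} (s : CompatibleFamily ι) (i : I) (g : G i) :
    s.lift (Monoid.PushoutI.of i g) = s.map i g :=
  Monoid.PushoutI.lift_of _ _ _ _

theorem CompatibleFamily.lift_base {ι : ∀ i, H →ₜ* G i} (s : CompatibleFamily ι) (x : H) :
    s.lift (Monoid.PushoutI.base _ x) = s.base x :=
  Monoid.PushoutI.lift_base _ _ _ _

variable [CompactSpace H] [∀ i, IsTopologicalGroup (G i)] [∀ i, T2Space (G i)]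
  {ι : ∀ i, H →ₜ* G i}

/-- Under the finiteness condition, compatible families separate the points of `H`. -/
theorem exists_compatibleFamily_base_ne_one [IsTopologicalGroup H] [T2Space H] {h : ∀ i, IsNormalEmbedding (ι i)} (hFIN : FIN h)
    {x : H} (hx : x ≠ 1) : ∃ s : CompatibleFamily ι, s.base x ≠ 1 := by
  obtain ⟨ρ, hρ, hρx⟩ := exists_irreducible_mat_ne_one hx
  cases isEmpty_or_nonempty I
  · exact ⟨⟨ρ.dim, ρ.toHom, isEmptyElim, isEmptyElim⟩, fun h1 => hρx (congrArg Subtype.val h1)⟩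
  · obtain ⟨n, k, j, hj, hk⟩ := exists_compatible_of_FIN hFIN hρ
    exact ⟨⟨n, k, j, hj⟩, fun h1 => hρx (hk x h1)⟩

/-- Compatible families that are trivial on `H` detect the alternating products of elements
outside `H`. -/
theorem exists_compatibleFamily_prod_ne_one [∀ i, CompactSpace (G i)]
    (h : ∀ i, IsNormalEmbedding (ι i))
    (w : List (Σ i, G i)) (hw : w ≠ []) (hne : ∀ l ∈ w, l.2 ∉ (ι l.1).toMonoidHom.range)
    (hch : w.IsChain fun l l' => l.1 ≠ l'.1) :
    ∃ s : CompatibleFamily ι, (∀ x, s.base x = 1) ∧ (w.map fun l => s.map l.1 l.2).prod ≠ 1 := by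
  have := fun i => (h i).normal
  have hcl : ∀ i, IsClosed ((ι i).toMonoidHom.range : Set (G i)) := fun i => by
    rw [MonoidHom.coe_range]
    exact (isCompact_range (ι i).continuous_toFun).isClosed
  -- Representations of the quotients `G i / H` are automatically compatible, since they are trivial
  -- on `H`.
  let Q : I → Type u := fun i => G i ⧸ (ι i).toMonoidHom.range
  have hT2 : ∀ i, T2Space (Q i) := fun i => by
    have := hcl i
    infer_instance
  let q : ∀ i, G i →ₜ* Q i := fun i =>
    { toMonoidHom := QuotientGroup.mk' _, continuous_toFun := continuous_quot_mk }
  let w' : List (Σ i, Q i) := w.map fun l => ⟨l.1, q l.1 l.2⟩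
  obtain ⟨n, σ, hσ⟩ := exists_wordMat_ne_one w' (by simpa [w'] using hw)
    (by
      intro l hl
      obtain ⟨l', hl', rfl⟩ := List.mem_map.1 hl
      exact fun h1 => hne l' hl' ((QuotientGroup.eq_one_iff _).1 h1))
    (by rwa [List.isChain_map])
  refine ⟨⟨n, 1, fun i => (σ i).comp (q i), fun i => ?_⟩, fun x => rfl, ?_⟩
  · ext1 x
    have : q i (ι i x) = 1 := (QuotientGroup.eq_one_iff _).2 ⟨x, rfl⟩
    change σ i (q i (ι i x)) = 1
    rw [this, map_one]
  · rw [List.map_map] at hσ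
    exact hσ

/-- Under the finiteness condition, compatible families separate the points of the amalgamated
product. -/
theorem exists_compatibleFamily_lift_ne_one [IsTopologicalGroup H] [T2Space H]
    [∀ i, CompactSpace (G i)] {h : ∀ i, IsNormalEmbedding (ι i)} (hFIN : FIN h)
    {x : Monoid.PushoutI (fun i => (ι i).toMonoidHom)} (hx : x ≠ 1) :
    ∃ s : CompatibleFamily ι, s.lift x ≠ 1 := by
  classical
  obtain ⟨d⟩ := Monoid.PushoutI.NormalWord.transversal_nonempty
    (fun i => (ι i).toMonoidHom) fun i => (h i).injective
  obtain ⟨w, rfl⟩ : ∃ w : Monoid.PushoutI.NormalWord d, w.prod = x :=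
    ⟨_, Monoid.PushoutI.NormalWord.equiv.symm_apply_apply x⟩
  have hlift : ∀ s : CompatibleFamily ι,
      s.lift w.prod = s.base w.head * (w.toList.map fun l => s.map l.1 l.2).prod := by
    intro s
    rw [Monoid.PushoutI.NormalWord.prod, map_mul, s.lift_base, Monoid.CoprodI.Word.prod,
      map_list_prod, map_list_prod, List.map_map, List.map_map]
    congr 3
  by_cases hnil : w.toList = []
  · have hhead : w.head ≠ 1 := by
      intro h1
      refine hx ?_
      rw [Monoid.PushoutI.NormalWord.prod, h1, Monoid.CoprodI.Word.prod, hnil, List.map_nil,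
        List.prod_nil, map_one, map_one, one_mul]
    obtain ⟨s, hs⟩ := exists_compatibleFamily_base_ne_one hFIN hhead
    refine ⟨s, ?_⟩
    rw [hlift, hnil]
    simpa using hs
  -- A family trivial on `H` ignores the head of the normal form, so only the letters matter.
  · obtain ⟨s, hs1, hs⟩ := exists_compatibleFamily_prod_ne_one h w.toList hnil
      (by
        rintro ⟨i, g⟩ hl hg
        refine w.ne_one _ hl ?_
        -- A letter in the image of `H` would factor both as `g * 1` and as `1 * g` over the
        -- transversal, hence be 1.
        have := (d.compl i).injective
          (a₁ := (⟨g, hg⟩, ⟨1, d.one_mem i⟩)) (a₂ := (1, ⟨g, w.normalized i g hl⟩)) (by simp)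
        exact congrArg Subtype.val (congrArg Prod.fst this))
      w.chain_ne
    refine ⟨s, ?_⟩
    rwa [hlift, hs1, one_mul]

end Pushout

end CompactGroups

/-! ### The compact pushout and the cycle of implications -/

namespace CompactGroups
open Matrix UnitaryRep

section Pushout

variable {I : Type u} {H : Type u} {G : I → Type u} [Group H] [TopologicalSpace H]
  [∀ i, Group (G i)] [∀ i, TopologicalSpace (G i)] (ι : ∀ i, H →ₜ* G i)

/-- The product of the unitary groups of all compatible families. -/
abbrev CompatibleProduct : Type u := ∀ s : CompatibleFamily ι, Matrix.unitaryGroup (Fin s.dim) ℂ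

/-- The product of the representations of the amalgamated product given by all compatible
families. -/
def universalRep : Monoid.PushoutI (fun i => (ι i).toMonoidHom) →* CompatibleProduct ι :=
  MonoidHom.pi fun s => s.lift

/-- The closure of the image of the amalgamated product in the product of the unitary groups of
all compatible families. -/
def compactPushout : Subgroup (CompatibleProduct ι) := (universalRep ι).range.topologicalClosure

instance : CompactSpace (compactPushout ι) :=
  isCompact_iff_compactSpace.1 (Subgroup.isClosed_topologicalClosure _).isCompact

theorem universalRep_mem (x : Monoid.PushoutI (fun i => (ι i).toMonoidHom)) :
    universalRep ι x ∈ compactPushout ι :=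
  Subgroup.le_topologicalClosure _ ⟨x, rfl⟩

/-- The structure map from `H` to the compact pushout. -/
def compactPushoutBase : H →ₜ* compactPushout ι where
  toFun x := ⟨universalRep ι (Monoid.PushoutI.base _ x), universalRep_mem ι _⟩
  map_one' := by simp only [map_one]; rfl
  map_mul' x y := by simp only [map_mul]; rfl
  continuous_toFun := by
    refine Continuous.subtype_mk (continuous_pi fun s => ?_) _
    have : (fun x => universalRep ι (Monoid.PushoutI.base _ x) s) = s.base :=
      funext s.lift_base
    rw [this]
    exact s.base.continuous_toFun

/-- The structure maps from the `G i` to the compact pushout. -/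
def compactPushoutOf (i : I) : G i →ₜ* compactPushout ι where
  toFun g := ⟨universalRep ι (Monoid.PushoutI.of i g), universalRep_mem ι _⟩
  map_one' := by simp only [map_one]; rfl
  map_mul' x y := by simp only [map_mul]; rfl
  continuous_toFun := by
    refine Continuous.subtype_mk (continuous_pi fun s => ?_) _
    have : (fun g => universalRep ι (Monoid.PushoutI.of i g) s) = s.map i :=
      funext (s.lift_of i)
    rw [this]
    exact (s.map i).continuous_toFun

theorem compactPushout_comm (i : I) :
    (compactPushoutOf ι i).comp (ι i) = compactPushoutBase ι := by
  ext1 x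
  exact Subtype.ext (congrArg (universalRep ι) (Monoid.PushoutI.of_apply_eq_base _ i x))

theorem coe_fromAlgebraicPushout (x : Monoid.PushoutI (fun i => (ι i).toMonoidHom)) :
    (fromAlgebraicPushout (compactPushout_comm ι) x : CompatibleProduct ι) =
      universalRep ι x := by
  have : (compactPushout ι).subtype.comp (fromAlgebraicPushout (compactPushout_comm ι)) =
      universalRep ι := by
    refine Monoid.PushoutI.hom_ext (fun i => ?_) ?_
    · ext1 g
      exact congrArg Subtype.val (fromAlgebraicPushout_of (compactPushout_comm ι) i g)
    · ext1 x
      exact congrArg Subtype.val (fromAlgebraicPushout_base (compactPushout_comm ι) x)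
  exact DFunLike.congr_fun this x

theorem denseRange_fromAlgebraicPushout :
    DenseRange (fromAlgebraicPushout (compactPushout_comm ι)) := by
  intro y
  rw [closure_subtype, ← Set.range_comp]
  have : (Subtype.val ∘ fromAlgebraicPushout (compactPushout_comm ι)) = universalRep ι :=
    funext (coe_fromAlgebraicPushout ι)
  rw [this]
  exact y.2

variable {ι}

/-- Morphisms out of the compact pushout that agree on `H` and on every `G i` are equal. -/
theorem compactPushout_hom_ext {K : Type u} [Group K] [TopologicalSpace K] [T2Space K]
    {φ ψ : compactPushout ι →ₜ* K}
    (hk : φ.comp (compactPushoutBase ι) = ψ.comp (compactPushoutBase ι))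
    (hj : ∀ i, φ.comp (compactPushoutOf ι i) = ψ.comp (compactPushoutOf ι i)) : φ = ψ := by
  refine DFunLike.coe_injective ((denseRange_fromAlgebraicPushout ι).equalizer
    φ.continuous_toFun ψ.continuous_toFun (funext ?_))
  refine DFunLike.congr_fun (f := φ.toMonoidHom.comp _) (g := ψ.toMonoidHom.comp _)
    (Monoid.PushoutI.hom_ext (fun i => ?_) ?_)
  · ext1 g
    have := DFunLike.congr_fun (hj i) g
    change φ (fromAlgebraicPushout _ _) = ψ (fromAlgebraicPushout _ _)
    rwa [fromAlgebraicPushout_of]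
  · ext1 g
    have := DFunLike.congr_fun hk g
    change φ (fromAlgebraicPushout _ _) = ψ (fromAlgebraicPushout _ _)
    rwa [fromAlgebraicPushout_base]

/-- The morphism out of the compact pushout given by a compatible family of morphisms. -/
theorem exists_compactPushout_desc {K : Type u} [Group K] [TopologicalSpace K]
    [IsTopologicalGroup K] [CompactSpace K] [T2Space K] (k : H →ₜ* K) (j : ∀ i, G i →ₜ* K)
    (h : ∀ i, (j i).comp (ι i) = k) :
    ∃ φ : compactPushout ι →ₜ* K,
      φ.comp (compactPushoutBase ι) = k ∧ ∀ i, φ.comp (compactPushoutOf ι i) = j i := by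
  -- Each representation of `K` pulls back to a compatible family. Thus `K`, embedded by Peter–Weyl
  -- in a product of unitary groups, is compared with the pushout through the coordinates `s π`.
  let s : UnitaryRep K → CompatibleFamily ι := fun π =>
    ⟨π.dim, π.toHom.comp k, fun i => π.toHom.comp (j i), fun i => by rw [← h i]; rfl⟩
  let E : K →* ∀ π : UnitaryRep K, Matrix.unitaryGroup (Fin π.dim) ℂ :=
    MonoidHom.pi fun π => π.toHom.toMonoidHom
  have hEc : Continuous E := continuous_pi fun π => π.toHom.continuous_toFun
  have hEinj : Injective E := (injective_iff_map_eq_one E).2 fun g hg => by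
    by_contra hg1
    obtain ⟨π, hπ⟩ := exists_mat_ne_one hg1
    exact hπ (congrArg Subtype.val (congrFun hg π))
  have hE := hEc.isClosedEmbedding hEinj
  let R : CompatibleProduct ι →* ∀ π : UnitaryRep K, Matrix.unitaryGroup (Fin π.dim) ℂ :=
    MonoidHom.pi fun π => Pi.evalMonoidHom _ (s π)
  have hRc : Continuous R := continuous_pi fun π => continuous_apply (s π)
  have hR : ∀ x, R (universalRep ι x) = E (fromAlgebraicPushout h x) := by
    refine DFunLike.congr_fun (f := R.comp (universalRep ι))
      (g := E.comp (fromAlgebraicPushout h)) (Monoid.PushoutI.hom_ext (fun i => ?_) ?_)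
    · ext1 g
      change R (universalRep ι (Monoid.PushoutI.of i g)) =
        E (fromAlgebraicPushout h (Monoid.PushoutI.of i g))
      rw [fromAlgebraicPushout_of]
      exact funext fun π => (s π).lift_of i g
    · ext1 g
      change R (universalRep ι (Monoid.PushoutI.base _ g)) =
        E (fromAlgebraicPushout h (Monoid.PushoutI.base _ g))
      rw [fromAlgebraicPushout_base]
      exact funext fun π => (s π).lift_base g
  -- The image of `K` is closed and contains the images of the amalgam, hence those of its closure.
  have hmem : ∀ y : compactPushout ι, ∃ z, E z = R y := by
    intro y
    have hcl : IsClosed (R ⁻¹' Set.range E) := hE.isClosed_range.preimage hRc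
    refine hcl.closure_subset_iff.2 ?_ y.2
    rintro _ ⟨x, rfl⟩
    exact ⟨_, (hR x).symm⟩
  choose φ hφ using hmem
  let Φ : compactPushout ι →ₜ* K :=
    { toFun := φ
      map_one' := hEinj (by rw [hφ, map_one]; exact map_one R)
      map_mul' := fun x y => hEinj (by rw [hφ, map_mul, hφ, hφ]; exact map_mul R _ _)
      continuous_toFun := by
        rw [hE.isInducing.continuous_iff]
        have : E ∘ φ = fun y : compactPushout ι => R y := funext hφ
        rw [this]
        exact hRc.comp continuous_subtype_val }
  have hΦ : ∀ x, ∀ hx, Φ ⟨universalRep ι x, hx⟩ = fromAlgebraicPushout h x := fun x hx =>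
    hEinj ((hφ _).trans (hR x))
  refine ⟨Φ, ?_, fun i => ?_⟩
  · ext1 x
    exact (hΦ _ _).trans (fromAlgebraicPushout_base h x)
  · ext1 g
    exact (hΦ _ _).trans (fromAlgebraicPushout_of h i g)

variable (ι) in
theorem isCompactPushout_compactPushout :
    IsCompactPushout ι (compactPushout ι) (compactPushoutBase ι) (compactPushoutOf ι) where
  comm := compactPushout_comm ι
  existsUnique_desc K _ _ _ _ _ k j h := by
    obtain ⟨φ, hk, hj⟩ := exists_compactPushout_desc k j h
    exact ⟨φ, ⟨hk, hj⟩, fun ψ hψ =>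
      compactPushout_hom_ext (hψ.1.trans hk.symm) fun i => (hψ.2 i).trans (hj i).symm⟩

/-- By the normal form theorem the factors of an amalgamated product embed in it. -/
theorem AlgebraicallySound.coherentlyEmbeddable (hι : ∀ i, Injective (ι i))
    (hs : AlgebraicallySound ι) : CoherentlyEmbeddable ι := by
  obtain ⟨P, _, _, _, _, _, k, j, hP, hinj⟩ := hs
  refine ⟨P, ‹_›, ‹_›, ‹_›, ‹_›, ‹_›, j, fun i a b hab => ?_, fun i i' => ?_⟩
  · refine Monoid.PushoutI.of_injective (φ := fun i => (ι i).toMonoidHom) hι i (hinj ?_)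
    rwa [fromAlgebraicPushout_of, fromAlgebraicPushout_of]
  · rw [hP.comm, hP.comm]

theorem CoherentlyEmbeddable.weakly (hι : ∀ i, Injective (ι i)) (hs : CoherentlyEmbeddable ι) :
    WeaklyCoherentlyEmbeddable ι := by
  obtain ⟨K, _, _, _, _, _, j, hj, hc⟩ := hs
  exact ⟨K, ‹_›, ‹_›, ‹_›, ‹_›, ‹_›, j, fun i => by exact (hj i).comp (hι i), hc⟩

variable [IsTopologicalGroup H] [CompactSpace H] [T2Space H] [∀ i, IsTopologicalGroup (G i)]
  [∀ i, T2Space (G i)]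

theorem WeaklyCoherentlyEmbeddable.fin (h : ∀ i, IsNormalEmbedding (ι i))
    (hs : WeaklyCoherentlyEmbeddable ι) : FIN h := by
  obtain ⟨K, _, _, _, _, _, f, hf, hc⟩ := hs
  cases isEmpty_or_nonempty I
  -- For an empty family nothing maps to the given group, so `H` itself serves as the target.
  · exact FIN_of_compatible h (k := ContinuousMonoidHom.id H) injective_id isEmptyElim isEmptyElim
  · inhabit I
    exact FIN_of_compatible h (hf default) f fun i => hc i default

/-- An element dying in the compact pushout dies under every compatible family, and under `FIN`
these separate points. -/
theorem FIN.algebraicallySound [∀ i, CompactSpace (G i)] {h : ∀ i, IsNormalEmbedding (ι i)} (hFIN : FIN h) :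
    AlgebraicallySound ι := by
  refine ⟨compactPushout ι, inferInstance, inferInstance, inferInstance, inferInstance,
    inferInstance, _, _, isCompactPushout_compactPushout ι, ?_⟩
  refine (injective_iff_map_eq_one _).2 fun x hx => ?_
  by_contra hx1
  obtain ⟨s, hs⟩ := exists_compatibleFamily_lift_ne_one hFIN hx1
  refine hs (congrFun (f := universalRep ι x) (g := 1) ?_ s)
  rw [← coe_fromAlgebraicPushout]
  exact congrArg Subtype.val hx

end Pushout

end CompactGroups

end

theorem mainTheorem3 {I : Type u} {H : Type u} {G : I → Type u}
    [Group H] [TopologicalSpace H] [IsTopologicalGroup H] [CompactSpace H] [T2Space H]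
    [∀ i, Group (G i)] [∀ i, TopologicalSpace (G i)] [∀ i, IsTopologicalGroup (G i)]
    [∀ i, CompactSpace (G i)] [∀ i, T2Space (G i)]
    (ι : ∀ i, H →ₜ* G i) (h : ∀ i, CompactGroups.IsNormalEmbedding (ι i)) :
    List.TFAE [
      CompactGroups.AlgebraicallySound ι,
      CompactGroups.CoherentlyEmbeddable ι,
      CompactGroups.WeaklyCoherentlyEmbeddable ι,
      CompactGroups.FIN h] := by
  have hι := fun i => (h i).injective
  tfae_have 1 → 2 := fun hs => hs.coherentlyEmbeddable hι
  tfae_have 2 → 3 := fun hs => hs.weakly hι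
  tfae_have 3 → 4 := fun hs => hs.fin h
  tfae_have 4 → 1 := fun hs => CompactGroups.FIN.algebraicallySound hs
  tfae_finish
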